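/- Let $\mathbb{F}$ be a field, let $k\ge 1$ and $d,n\ge 0$ be integers with $|\mathbb{F}|>d$, and let $L(R)$ be the vector space of linear forms $\sum_i a_ix_i$ in $R=\mathbb{F}[x_1,\dots,x_n]$. Let $C=\sum_{i=1}^k T_i$ be a $\Sigma\Pi\Sigma(k,d)$ circuit, i.e. $T_i=c_i\prod_{j=1}^d \ell_{i,j}$ with $c_i\in\mathbb{F}^*$ and $\ell_{i,j}\in L(R)\setminus\{0\}$; write $L(T_i)$ for the list $(\ell_{i,1},\dots,\ell_{i,d})$. Assume that $C$ is an identity ($\sum_i T_i=0$ in $R$), simple (no nonzero linear form divides all the $T_i$) and strongly minimal ($T_1,\dots,T_{k-1}$ are linearly independent over $\mathbb{F}$); these assumptions force $k\ge 2$. Let $\mathcal I\subseteq\{1,\dots,k\}$ be a maximal set such that the $T_i$, $i\in\mathcal I$, are linearly independent. A linear subspace $K\subseteq L(R)$ is called a nucleus of $C$ (with respect to $\mathcal I$) if (1) $\dim K<2k^2$; (2) for every $i$ there is a bijection $\pi_i$ between the lists $L(T_1)$ and $L(T_i)$ with $\pi_i(\ell)\in\mathbb{F}^*\ell+K$ for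 all $\ell\in L(T_1)$; (3) the polynomials $K_i:=\prod_{j:\,\ell_{i,j}\in K}\ell_{i,j}$, $i\in\mathcal I$, are linearly independent. For $r\ge 1$, a set $S$ of nonzero vectors in $\mathbb{F}^N$, no two of which are scalar multiples of each other, is called $\mathrm{SG}_r$-closed if the linear span of any $r$ linearly independent vectors of $S$ contains at least $r+1$ vectors of $S$; $\mathrm{SG}_r(\mathbb{F},m)$ denotes the largest rank of an $\mathrm{SG}_r$-closed set of at most $m$ vectors in $\mathbb{F}^N$, over all $N$. Then $C$ has a nucleus, and for every nucleus $K$ of $C$ the non-nucleus rank of $C$, i.e. the rank in the quotient space $L(R)/K$ of the set of all forms $\ell_{i,j}$ ($1\le i\le k$, $1\le j\le d$) with $\ell_{i,j}\notin K$, is at most $\mathrm{SG}_{k-1}(\mathbb{F},d)$. -/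

import Mathlib

noncomputable section

namespace DepthThree

/-- The space of linear forms `∑ aᵢ xᵢ` in `F[x₁, …, xₙ]`. -/
abbrev LinForms (F : Type*) [Field F] (n : ℕ) : Submodule F (MvPolynomial (Fin n) F) :=
  MvPolynomial.homogeneousSubmodule (Fin n) F 1

/-- A `ΣΠΣ(k,d)` circuit in `n` variables over `F`: `k` multiplication terms, each a nonzero
constant times a product of a list of `d` nonzero linear forms. -/
structure Circuit (F : Type*) [Field F] (n k d : ℕ) where
  coeff : Fin k → F
  form : Fin k → Fin d → LinForms F n
  coeff_ne_zero : ∀ i, coeff i ≠ 0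
  form_ne_zero : ∀ i j, form i j ≠ 0

/-- `π` is an `I`-matching between the lists `U` and `V`: a bijection between the lists with
`π(ℓ) ∈ F^* ℓ + I` for every entry `ℓ` of `U`. -/
def IsMatching {F M ι κ : Type*} [Field F] [AddCommGroup M] [Module F M]
    (I : Submodule F M) (U : ι → M) (V : κ → M) (π : ι ≃ κ) : Prop :=
  ∀ j, ∃ c : F, c ≠ 0 ∧ ∃ v ∈ I, V (π j) = c • U j + v

/-- The rank of a set `S` of vectors modulo the subspace `K`. -/
def rankMod {F M : Type*} [Field F] [AddCommGroup M] [Module F M]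
    (K : Submodule F M) (S : Set M) : ℕ :=
  Set.finrank F (K.mkQ '' S)

namespace Circuit

variable {F : Type*} [Field F] {n k d : ℕ}

/-- The polynomial computed by the `i`-th multiplication term. -/
def term (C : Circuit F n k d) (i : Fin k) : MvPolynomial (Fin n) F :=
  MvPolynomial.C (C.coeff i) * ∏ j, (C.form i j : MvPolynomial (Fin n) F)

/-- The circuit computes the zero polynomial. -/
def IsIdentity (C : Circuit F n k d) : Prop :=
  ∑ i, C.term i = 0

/-- No nonzero linear form divides all the terms. -/
def IsSimple (C : Circuit F n k d) : Prop :=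
  ¬ ∃ ℓ : LinForms F n, ℓ ≠ 0 ∧ ∀ i, (ℓ : MvPolynomial (Fin n) F) ∣ C.term i

/-- All the terms but the last one are linearly independent. -/
def IsStronglyMinimal (C : Circuit F n k d) : Prop :=
  LinearIndepOn F C.term {i : Fin k | (i : ℕ) + 1 < k}

open Classical in
/-- The product of those forms (with multiplicity) of the `i`-th term that lie in `K`. -/
def nucleusTerm (C : Circuit F n k d) (K : Submodule F (LinForms F n)) (i : Fin k) :
    MvPolynomial (Fin n) F :=
  ∏ j with C.form i j ∈ K, (C.form i j : MvPolynomial (Fin n) F)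

/-- `K` is a nucleus of `C` with respect to the index set `I` (which is to index a maximal
linearly independent set of terms). -/
structure IsNucleus [NeZero k] (C : Circuit F n k d) (I : Set (Fin k))
    (K : Submodule F (LinForms F n)) : Prop where
  rank_lt : Module.finrank F K < 2 * k ^ 2
  matched : ∀ i, ∃ π : Fin d ≃ Fin d, IsMatching K (C.form 0) (C.form i) π
  indep : LinearIndepOn F (C.nucleusTerm K) I

/-- The forms occurring in `C` that lie outside `K`. -/
def nonNucleusPart (C : Circuit F n k d) (K : Submodule F (LinForms F n)) :
    Set (LinForms F n) :=
  {ℓ | (∃ i j, C.form i j = ℓ) ∧ ℓ ∉ K}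

/-- The rank modulo `K` of the forms of `C` that lie outside `K`. -/
def nonNucleusRank (C : Circuit F n k d) (K : Submodule F (LinForms F n)) : ℕ :=
  rankMod K (C.nonNucleusPart K)

end Circuit

/-- `S` is a set of nonzero vectors, no two of which are multiples of each other, such that the
span of any `k` linearly independent vectors of `S` contains at least `k + 1` vectors of `S`. -/
structure IsSGClosed (F : Type*) {M : Type*} [Field F] [AddCommGroup M] [Module F M]
    (k : ℕ) (S : Set M) : Prop where
  ne_zero : ∀ v ∈ S, v ≠ 0
  no_multiples : ∀ v ∈ S, ∀ w ∈ S, v ≠ w → ∀ c : F, w ≠ c • v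
  closed : ∀ V : Finset M, (V : Set M) ⊆ S → V.card = k → LinearIndepOn F id (V : Set M) →
    ((k + 1 : ℕ) : ℕ∞) ≤ (S ∩ (Submodule.span F (V : Set M) : Set M)).encard

/-- The ranks of the `SG_k`-closed sets of at most `m` vectors in `Fⁿ`, over all `n`. -/
def sgRanks (k : ℕ) (F : Type*) [Field F] (m : ℕ) : Set ℕ :=
  {r | ∃ (n : ℕ) (S : Set (Fin n → F)),
    S.encard ≤ m ∧ IsSGClosed F k S ∧ Set.finrank F S = r}

/-- `SG_k(F,m)`: the largest rank of an `SG_k`-closed set of at most `m` vectors in `Fⁿ`,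
over all `n`. -/
def SG (k : ℕ) (F : Type*) [Field F] (m : ℕ) : ℕ :=
  sSup (sgRanks k F m)

/-- The supremum defining `SG k F m` is an attained maximum when `k ≥ 1`. -/
theorem SG_isGreatest {k : ℕ} (hk : 1 ≤ k) (F : Type*) [Field F] (m : ℕ) :
    IsGreatest (sgRanks k F m) (SG k F m) := by
  have hb : BddAbove (sgRanks k F m) := by
    refine ⟨m, ?_⟩
    rintro r ⟨n, S, hS, -, rfl⟩
    have hfin : S.Finite := Set.finite_of_encard_le_coe hS
    have h1 : Set.finrank F S ≤ S.ncard := by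
      have := hfin.fintype
      rw [Set.ncard_eq_toFinset_card']
      exact finrank_span_le_card S
    refine h1.trans ?_
    rw [← hfin.cast_ncard_eq] at hS
    exact_mod_cast hS
  have hne : (sgRanks k F m).Nonempty := by
    refine ⟨_, 0, ∅, by simp, ⟨by simp, by simp, ?_⟩, rfl⟩
    intro V hV hc
    have : V = ∅ := by simpa using hV
    subst this
    simp at hc
    omega
  exact ⟨Nat.sSup_mem hne hb, fun r hr => le_csSup hb hr⟩

end DepthThree

end

/-!
Existence of a nucleus. Call an ideal `p` supported on `K` if it is generated by polynomials in the
forms of `K`. If two products of linear forms are proportional modulo such a `p`, but not in `p`,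
split the space of linear forms as `K ⊕ K'` and compare the top degree parts in the variables of
`K'`: the factors of the two products agree up to order, nonzero constants and elements of `K`.
Given a nonzero `D` in the span of the terms, go through the terms `T` one by one. If `D` is in
`p + (T)`, then `T` is in the line of `D` modulo `p`; otherwise, by Chinese remaindering, some
factor of `T` supported on a single further form can be added to `p` without swallowing `D`. At the
end `D ∉ p` and modulo `p` the span of the terms is the line of `D`. By strong minimality a proper
nonempty subsum `D` of the terms is nonzero, so some term inside the subsum and some term outside it
are nonzero and hence proportional modulo `p`. A single `K` that is good for all `D` thus matches
all the terms.

Rank bound. Take `k - 1` independent directions `s` modulo a nucleus `K` and suppose that no further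
direction of `C` lies in their span. Replacing these directions by variables `X s`, the identity
turns into a relation `∑ uᵢ ∏ₛ fᵢₛ(X s) = 0` with monic `fᵢₛ`, that is, a relation between `k`
elementary tensors with `k - 1` factors. No proper subsum of the `uᵢ` vanishes, which forces
`fᵢₛ` to be independent of `i` for some `s`: otherwise each factor would cut the dimension of the
space of relations. A common root of the `fᵢₛ` is a linear form dividing all terms, against
simplicity. So the directions form a Sylvester-Gallai closed set.
-/

noncomputable section

namespace DepthThree

open MvPolynomial

section LinearAlgebra

variable {F M N ι : Type*} [Field F] [AddCommGroup M] [Module F M] [AddCommGroup N] [Module F N]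

/-- Being nonzero multiples of each other modulo `K`; this is the relation between matched forms
in `IsMatching`. -/
def proportionalMod (K : Submodule F M) : Setoid M where
  r x y := ∃ c : F, c ≠ 0 ∧ ∃ v ∈ K, y = c • x + v
  iseqv :=
    { refl := fun x => ⟨1, one_ne_zero, 0, K.zero_mem, by simp⟩
      symm := by
        rintro x y ⟨c, hc, v, hv, rfl⟩
        exact ⟨c⁻¹, inv_ne_zero hc, -(c⁻¹ • v), K.neg_mem (K.smul_mem _ hv), by
          rw [smul_add, inv_smul_smul₀ hc, add_neg_cancel_right]⟩
      trans := by
        rintro x y z ⟨c, hc, v, hv, rfl⟩ ⟨e, he, w, hw, rfl⟩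
        exact ⟨e * c, mul_ne_zero he hc, e • v + w, add_mem (K.smul_mem _ hv) hw, by
          rw [smul_add, smul_smul, add_assoc]⟩ }

theorem proportionalMod_mono {K K' : Submodule F M} (h : K ≤ K') {x y : M}
    (hxy : proportionalMod K x y) : proportionalMod K' x y := by
  obtain ⟨c, hc, v, hv, hy⟩ := hxy
  exact ⟨c, hc, v, h hv, hy⟩

theorem proportionalMod_of_mem {K : Submodule F M} {x y : M} (hx : x ∈ K) (hy : y ∈ K) :
    proportionalMod K x y :=
  ⟨1, one_ne_zero, y - x, sub_mem hy hx, by rw [one_smul, add_sub_cancel]⟩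

theorem mem_iff_of_proportionalMod {K : Submodule F M} {x y : M} (h : proportionalMod K x y) :
    x ∈ K ↔ y ∈ K := by
  obtain ⟨c, hc, v, hv, rfl⟩ := h
  rw [add_mem_cancel_right hv, K.smul_mem_iff hc]

theorem exists_linearMap_of_linearIndependent_mkQ {K : Submodule F M} {w : ι → M}
    (hw : LinearIndependent F (K.mkQ ∘ w)) (f : M →ₗ[F] N) (y : ι → N) :
    ∃ g : M →ₗ[F] N, (∀ x ∈ K, g x = f x) ∧ ∀ i, g (w i) = y i := by
  obtain ⟨c, hc⟩ := LinearMap.exists_leftInverse_of_injective _ (LinearMap.ker_eq_bot.mpr hw)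
  refine ⟨f + Finsupp.linearCombination F (fun i => y i - f (w i)) ∘ₗ c ∘ₗ K.mkQ,
    fun x hx => ?_, fun i => ?_⟩
  · have hx0 : K.mkQ x = 0 := (Submodule.Quotient.mk_eq_zero K).mpr hx
    simp [hx0]
  · have hci : c (K.mkQ (w i)) = Finsupp.single i 1 := by
      simpa using DFunLike.congr_fun hc (Finsupp.single i 1)
    rw [LinearMap.add_apply, LinearMap.comp_apply, LinearMap.comp_apply, hci]
    simp

theorem exists_dual_eq_one_of_notMem {K : Submodule F M} {x : M} (hx : x ∉ K) :
    ∃ φ : M →ₗ[F] F, φ x = 1 ∧ ∀ y ∈ K, φ y = 0 := by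
  have hind : LinearIndependent F (K.mkQ ∘ fun _ : Unit => x) :=
    linearIndependent_unique_iff.mpr fun h => hx ((Submodule.Quotient.mk_eq_zero K).mp h)
  obtain ⟨φ, hφK, hφ⟩ := exists_linearMap_of_linearIndependent_mkQ hind (0 : M →ₗ[F] F) 1
  exact ⟨φ, hφ (), hφK⟩

theorem exists_endomorphism_ker_eq (K : Submodule F M) :
    ∃ q : M →ₗ[F] M, LinearMap.ker q = K := by
  obtain ⟨K', hK'⟩ := K.exists_isCompl
  exact ⟨_, Submodule.ker_projection hK'.symm⟩

theorem le_span_singleton_sup_of_mem {P W : Submodule F M} {x y : M}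
    (hW : W ≤ Submodule.span F {x} ⊔ P) (hy : y ∈ W) (hyP : y ∉ P) :
    W ≤ Submodule.span F {y} ⊔ P := by
  have hx : x ∈ Submodule.span F {y} ⊔ P := by
    obtain ⟨z, hz, p, hp, hzp⟩ := Submodule.mem_sup.mp (hW hy)
    obtain ⟨c, rfl⟩ := Submodule.mem_span_singleton.mp hz
    have hc : c ≠ 0 := by
      rintro rfl
      exact hyP (by rwa [← hzp, zero_smul, zero_add])
    rw [← (Submodule.span F {y} ⊔ P).smul_mem_iff hc, eq_sub_of_add_eq hzp]
    exact sub_mem (Submodule.mem_sup_left (Submodule.mem_span_singleton_self y))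
      (Submodule.mem_sup_right hp)
  exact hW.trans (sup_le ((Submodule.span_singleton_le_iff_mem _ _).mpr hx) le_sup_right)

theorem exists_smul_eq_of_smul_eq_smul {x y : M} (hy : y ≠ 0) {f g : ι → F}
    (h : ∀ i, f i • x = g i • y) (hf : f ≠ 0) : ∃ c : F, g = c • f := by
  obtain ⟨i₀, hi₀⟩ := Function.ne_iff.mp hf
  have hx : x = ((f i₀)⁻¹ * g i₀) • y := by rw [mul_smul, ← h, inv_smul_smul₀ hi₀]
  refine ⟨(f i₀)⁻¹ * g i₀, funext fun i => smul_left_injective F hy ?_⟩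
  simp only [Pi.smul_apply, smul_eq_mul]
  rw [mul_comm, mul_smul, ← hx, h]

theorem linearIndepOn_smul_iff {v : ι → M} {a : ι → F} (ha : ∀ i, a i ≠ 0) {s : Set ι} :
    LinearIndepOn F (fun i => a i • v i) s ↔ LinearIndepOn F v s :=
  LinearIndependent.units_smul_iff (fun i : s => v i) fun i => Units.mk0 (a i) (ha i)

section ZeroSum

variable [Fintype ι]

/-- No nonempty proper subfamily of the finite family `u` sums to zero. -/
def NoProperZeroSubsum (u : ι → M) : Prop :=
  ∀ S : Finset ι, ∑ i ∈ S, u i = 0 → S.Nonempty → S = Finset.univ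

theorem eq_of_sum_smul_eq_zero {v : ι → M} {l : ι} (hv : LinearIndepOn F v {i | i ≠ l})
    (hsum : ∑ i, v i = 0) {a : ι → F} (ha : ∑ i, a i • v i = 0) (i : ι) : a i = a l := by
  classical
  by_cases hi : i = l
  · rw [hi]
  have hdiff : ∑ j ∈ Finset.univ.erase l, (a j - a l) • v j = 0 := by
    rw [Finset.sum_erase _ (by rw [sub_self, zero_smul])]
    simp only [sub_smul, Finset.sum_sub_distrib, ha, ← Finset.smul_sum, hsum, smul_zero, sub_zero]
  exact sub_eq_zero.mp <| linearIndepOn_iff'.mp hv _ (fun j => a j - a l)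
    (fun j hj => Finset.ne_of_mem_erase hj) hdiff i (by simpa using hi)

theorem linearIndepOn_ne_of_sum_eq_zero {v : ι → M} {l : ι} (hv : LinearIndepOn F v {i | i ≠ l})
    (hsum : ∑ i, v i = 0) (l' : ι) : LinearIndepOn F v {i | i ≠ l'} := by
  classical
  refine linearIndepOn_iff'.mpr fun t a ht ha i hi => ?_
  have hext : ∑ j, (if j ∈ t then a j else 0) • v j = 0 := by
    simpa only [ite_smul, zero_smul, Finset.sum_ite_mem, Finset.univ_inter] using ha
  have hconst := eq_of_sum_smul_eq_zero hv hsum hext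
  have hl' : l' ∉ t := fun h => ht h rfl
  simpa only [if_pos hi, if_neg hl'] using (hconst i).trans (hconst l').symm

theorem noProperZeroSubsum_of_linearIndepOn_ne {v : ι → M} {l : ι}
    (hv : LinearIndepOn F v {i | i ≠ l}) (hsum : ∑ i, v i = 0) : NoProperZeroSubsum v := by
  classical
  rintro S hS ⟨i, hi⟩
  have hext : ∑ j, (if j ∈ S then (1 : F) else 0) • v j = 0 := by
    simpa only [ite_smul, one_smul, zero_smul, Finset.sum_ite_mem, Finset.univ_inter] using hS
  have hconst := eq_of_sum_smul_eq_zero hv hsum hext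
  refine Finset.eq_univ_of_forall fun j => by_contra fun hj => ?_
  simpa [hi, hj] using (hconst i).trans (hconst j).symm

end ZeroSum

end LinearAlgebra

section Polynomial

variable {σ ι R : Type*} [CommRing R]

theorem homogeneousComponent_add_mul {P : MvPolynomial σ R} {a : ℕ} (hP : P.IsHomogeneous a)
    (f : MvPolynomial σ R) (b : ℕ) :
    homogeneousComponent (a + b) (P * f) = P * homogeneousComponent b f := by
  let := gradedAlgebra (σ := σ) (R := R)
  simpa only [← DirectSum.Decomposition.decompose'_eq, decomposition.decompose'_apply] using
    DirectSum.coe_decompose_mul_add_of_left_mem (homogeneousSubmodule σ R) (b := f) (j := b) hP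

theorem totalDegree_prod_C_add_le (s : Finset ι) (a : ι → R) {g : ι → MvPolynomial σ R}
    (hg : ∀ j, (g j).IsHomogeneous 1) : (∏ j ∈ s, (C (a j) + g j)).totalDegree ≤ s.card := by
  refine (totalDegree_finsetProd _ _).trans ?_
  refine (Finset.sum_le_card_nsmul _ _ 1 fun j _ => (totalDegree_add _ _).trans ?_).trans_eq
    (by rw [smul_eq_mul, mul_one])
  exact max_le ((totalDegree_C _).trans_le zero_le_one) (hg j).totalDegree_le

theorem homogeneousComponent_card_prod_C_add (s : Finset ι) (a : ι → R) {g : ι → MvPolynomial σ R}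
    (hg : ∀ j, (g j).IsHomogeneous 1) :
    homogeneousComponent s.card (∏ j ∈ s, (C (a j) + g j)) = ∏ j ∈ s, g j := by
  classical
  induction s using Finset.induction_on with
  | empty => simp [homogeneousComponent_zero]
  | insert j s hj ih =>
    have hlow : homogeneousComponent (s.card + 1) (∏ j ∈ s, (C (a j) + g j)) = 0 :=
      homogeneousComponent_eq_zero _ _ (Nat.lt_succ_of_le (totalDegree_prod_C_add_le s a hg))
    rw [Finset.prod_insert hj, Finset.prod_insert hj, Finset.card_insert_of_notMem hj, add_mul,
      map_add, homogeneousComponent_C_mul, hlow, mul_zero, zero_add, add_comm,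
      homogeneousComponent_add_mul (hg j), ih]

theorem homogeneousComponent_mul_eq_smul {P : MvPolynomial σ R} {a : ℕ} (hP : P.IsHomogeneous a)
    (f : MvPolynomial σ R) : homogeneousComponent a (P * f) = f.coeff 0 • P := by
  rw [← add_zero a, homogeneousComponent_add_mul hP, homogeneousComponent_zero, mul_comm,
    MvPolynomial.smul_eq_C_mul]

theorem exists_equiv_associated {A κ : Type*} [CommMonoidWithZero A]
    [UniqueFactorizationMonoid A] [Fintype ι] [Fintype κ] {a : ι → A} {b : κ → A}
    (ha : ∀ i, Irreducible (a i)) (hb : ∀ j, Irreducible (b j))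
    (h : Associated (∏ i, a i) (∏ j, b j)) :
    ∃ e : ι ≃ κ, ∀ i, Associated (a i) (b (e i)) := by
  classical
  have hrel : Multiset.Rel Associated (Finset.univ.val.map a) (Finset.univ.val.map b) :=
    UniqueFactorizationMonoid.factors_unique
      (by simpa only [Multiset.mem_map, Finset.mem_val, Finset.mem_univ, true_and,
        forall_exists_index, forall_apply_eq_imp_iff] using ha)
      (by simpa only [Multiset.mem_map, Finset.mem_val, Finset.mem_univ, true_and,
        forall_exists_index, forall_apply_eq_imp_iff] using hb) h
  rw [Associates.rel_associated_iff_map_eq_map, Multiset.map_map, Multiset.map_map] at hrel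
  have hfiber (c : Associates A) : Fintype.card {i // Associates.mk (a i) = c} =
      Fintype.card {j // Associates.mk (b j) = c} := by
    simpa only [Multiset.count_map, Function.comp_apply, Fintype.card_subtype, Finset.card_def,
      Finset.filter_val, eq_comm] using congrArg (Multiset.count c) hrel
  let e (c : Associates A) := Fintype.equivOfCardEq (hfiber c)
  exact ⟨Equiv.ofFiberEquiv e, fun i =>
    (Associates.mk_eq_mk_iff_associated.mp (Equiv.ofFiberEquiv_map e i)).symm⟩

end Polynomial

section LinearForms

variable {F : Type*} [Field F] {n : ℕ} {ι B : Type*} [CommRing B] [Algebra F B]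

/-- The variable `xᵢ` as a linear form. -/
def varForm (F : Type*) [Field F] {n : ℕ} (i : Fin n) : LinForms F n :=
  ⟨X i, isHomogeneous_X F i⟩

instance finite_linForms : Module.Finite F (LinForms F n) :=
  Module.Finite.iff_fg.mpr (homogeneousSubmodule_fg (Fin n) F 1)

theorem span_range_varForm :
    Submodule.span F (Set.range (varForm F : Fin n → LinForms F n)) = ⊤ := by
  apply Submodule.map_injective_of_injective (LinForms F n).injective_subtype
  rw [Submodule.map_span, ← Set.range_comp, Submodule.map_top, Submodule.range_subtype]
  exact (homogeneousSubmodule_one_eq_span_X ..).symm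

theorem algHom_ext_linForms {f g : MvPolynomial (Fin n) F →ₐ[F] B}
    (h : ∀ x : LinForms F n, f x = g x) : f = g :=
  algHom_ext fun i => h (varForm F i)

/-- The algebra homomorphism on the polynomial ring extending a linear map on linear forms. -/
def liftLin (φ : LinForms F n →ₗ[F] B) : MvPolynomial (Fin n) F →ₐ[F] B :=
  aeval fun i => φ (varForm F i)

theorem liftLin_coe (φ : LinForms F n →ₗ[F] B) (x : LinForms F n) : liftLin φ x = φ x := by
  have h : (liftLin φ).toLinearMap ∘ₗ (LinForms F n).subtype = φ :=
    LinearMap.ext_on span_range_varForm (by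
      rintro _ ⟨i, rfl⟩
      exact aeval_X _ i)
  exact DFunLike.congr_fun h x

/-- The product of the linear forms `ℓ j`, `j ∈ s`, as a polynomial. -/
def formProd (s : Finset ι) (ℓ : ι → LinForms F n) : MvPolynomial (Fin n) F :=
  ∏ j ∈ s, (ℓ j : MvPolynomial (Fin n) F)

theorem formProd_isHomogeneous (s : Finset ι) (ℓ : ι → LinForms F n) :
    (formProd s ℓ).IsHomogeneous s.card := by
  rw [formProd, Finset.card_eq_sum_ones]
  exact IsHomogeneous.prod s _ (fun _ => 1) fun j _ => (ℓ j).2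

theorem formProd_ne_zero {s : Finset ι} {ℓ : ι → LinForms F n} (h : ∀ j ∈ s, ℓ j ≠ 0) :
    formProd s ℓ ≠ 0 :=
  Finset.prod_ne_zero_iff.mpr fun j hj => by simpa using h j hj

theorem liftLin_formProd (φ : LinForms F n →ₗ[F] B) (s : Finset ι) (ℓ : ι → LinForms F n) :
    liftLin φ (formProd s ℓ) = ∏ j ∈ s, φ (ℓ j) := by
  simp only [formProd, map_prod, liftLin_coe]

theorem formProd_filter_mul_filter_not (s : Finset ι) (P : ι → Prop) [DecidablePred P]
    [∀ j, Decidable (¬ P j)] (ℓ : ι → LinForms F n) :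
    formProd {j ∈ s | P j} ℓ * formProd {j ∈ s | ¬ P j} ℓ = formProd s ℓ :=
  Finset.prod_filter_mul_prod_filter_not s P _

theorem irreducible_coe_of_ne_zero {x : LinForms F n} (hx : x ≠ 0) :
    Irreducible (x : MvPolynomial (Fin n) F) := by
  have hx' : (x : MvPolynomial (Fin n) F) ≠ 0 := by simpa using hx
  refine irreducible_of_totalDegree_eq_one (IsHomogeneous.totalDegree x.2 hx') fun c hc => ?_
  rw [isUnit_iff_ne_zero]
  rintro rfl
  exact hx' (MvPolynomial.ext _ _ fun m => by simpa using hc m)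

theorem exists_smul_eq_of_associated_coe {x y : LinForms F n}
    (h : Associated (x : MvPolynomial (Fin n) F) (y : MvPolynomial (Fin n) F)) :
    ∃ c : F, c ≠ 0 ∧ y = c • x := by
  obtain ⟨u, hu⟩ := h
  obtain ⟨c, hc, hcu⟩ := MvPolynomial.isUnit_iff_eq_C_of_isReduced.mp u.isUnit
  refine ⟨c, hc.ne_zero, Subtype.ext ?_⟩
  rw [Submodule.coe_smul, ← hu, hcu, mul_comm, MvPolynomial.smul_eq_C_mul]

end LinearForms

section SupportedIdeals

variable {F : Type*} [Field F] {n : ℕ} {ι B : Type*} [CommRing B] [Algebra F B]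
  {K K' : Submodule F (LinForms F n)} {p : Ideal (MvPolynomial (Fin n) F)}

/-- The subalgebra of polynomials in the linear forms of `K`. -/
def formAlgebra (K : Submodule F (LinForms F n)) : Subalgebra F (MvPolynomial (Fin n) F) :=
  Algebra.adjoin F (Subtype.val '' (K : Set (LinForms F n)))

theorem formAlgebra_mono (h : K ≤ K') : formAlgebra K ≤ formAlgebra K' :=
  Algebra.adjoin_mono (Set.image_mono h)

theorem formProd_mem_formAlgebra {s : Finset ι} {ℓ : ι → LinForms F n} (h : ∀ j ∈ s, ℓ j ∈ K) :
    formProd s ℓ ∈ formAlgebra K :=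
  prod_mem fun j hj => Algebra.subset_adjoin ⟨ℓ j, h j hj, rfl⟩

theorem liftLin_eq_of_mem_formAlgebra {φ : LinForms F n →ₗ[F] B}
    {c : MvPolynomial (Fin n) F →ₐ[F] B} (h : ∀ x ∈ K, φ x = c x)
    {a : MvPolynomial (Fin n) F} (ha : a ∈ formAlgebra K) : liftLin φ a = c a := by
  have hle : formAlgebra K ≤ AlgHom.equalizer (liftLin φ) c := by
    refine Algebra.adjoin_le ?_
    rintro _ ⟨x, hx, rfl⟩
    rw [SetLike.mem_coe, AlgHom.mem_equalizer, liftLin_coe, h x hx]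
  exact hle ha

/-- The ideal `p` is generated by homogeneous polynomials in the linear forms of `K`. -/
def IsSupportedOn (K : Submodule F (LinForms F n)) (p : Ideal (MvPolynomial (Fin n) F)) : Prop :=
  ∃ G : Set (MvPolynomial (Fin n) F),
    (∀ g ∈ G, g ∈ formAlgebra K ∧ ∃ m, g.IsHomogeneous m) ∧ p = Ideal.span G

namespace IsSupportedOn

theorem bot : IsSupportedOn K ⊥ :=
  ⟨∅, by simp, by simp⟩

theorem mono (h : K ≤ K') (hp : IsSupportedOn K p) : IsSupportedOn K' p := by
  obtain ⟨G, hG, rfl⟩ := hp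
  exact ⟨G, fun g hg => ⟨formAlgebra_mono h (hG g hg).1, (hG g hg).2⟩, rfl⟩

theorem sup_span_formProd (hp : IsSupportedOn K p) {s : Finset ι} {ℓ : ι → LinForms F n}
    (hℓ : ∀ j ∈ s, ℓ j ∈ K) : IsSupportedOn K (p ⊔ Ideal.span {formProd s ℓ}) := by
  obtain ⟨G, hG, rfl⟩ := hp
  refine ⟨G ∪ {formProd s ℓ}, ?_, (Ideal.span_union _ _).symm⟩
  rintro g (hg | rfl)
  · exact hG g hg
  · exact ⟨formProd_mem_formAlgebra hℓ, _, formProd_isHomogeneous s ℓ⟩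

theorem homogeneousComponent_mem (hp : IsSupportedOn K p) {f : MvPolynomial (Fin n) F}
    (hf : f ∈ p) (m : ℕ) : homogeneousComponent m f ∈ p := by
  let := gradedAlgebra (σ := Fin n) (R := F)
  refine homogeneousComponent_mem_of_mem ?_ hf m
  obtain ⟨G, hG, rfl⟩ := hp
  exact Ideal.homogeneous_span _ _ fun g hg => (hG g hg).2

theorem liftLin_mem (hp : IsSupportedOn K p) {φ : LinForms F n →ₗ[F] B}
    {c : MvPolynomial (Fin n) F →ₐ[F] B} (h : ∀ x ∈ K, φ x = c x)
    {f : MvPolynomial (Fin n) F} (hf : f ∈ p) : liftLin φ f ∈ p.map c := by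
  obtain ⟨G, hG, rfl⟩ := hp
  have hle : Ideal.span G ≤ (Ideal.map c (Ideal.span G)).comap (liftLin φ) := by
    refine Ideal.span_le.mpr fun g hg => ?_
    rw [SetLike.mem_coe, Ideal.mem_comap, liftLin_eq_of_mem_formAlgebra h (hG g hg).1]
    exact Ideal.mem_map_of_mem _ (Ideal.subset_span hg)
  exact hle hf

/-- A form outside `K` can be moved to a new variable `t` by a substitution that fixes `K` and
therefore preserves `p`; modulo `p` extended to the polynomials in `t`, multiplication by `t` is
injective. -/
theorem mem_of_coe_mul_mem (hp : IsSupportedOn K p) {ℓ : LinForms F n} (hℓ : ℓ ∉ K)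
    {f : MvPolynomial (Fin n) F} (hf : (ℓ : MvPolynomial (Fin n) F) * f ∈ p) : f ∈ p := by
  obtain ⟨φ, hφ, hφK⟩ := exists_dual_eq_one_of_notMem hℓ
  let c : MvPolynomial (Fin n) F →ₐ[F] Polynomial (MvPolynomial (Fin n) F) := Polynomial.CAlgHom
  let Φ : LinForms F n →ₗ[F] Polynomial (MvPolynomial (Fin n) F) :=
    c.toLinearMap ∘ₗ Submodule.subtype _ + φ.smulRight (Polynomial.X - c ℓ)
  have hΦ (x : LinForms F n) : Φ x = c x + φ x • (Polynomial.X - c ℓ) := rfl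
  have hΦK (x : LinForms F n) (hx : x ∈ K) : Φ x = c x := by
    rw [hΦ, hφK x hx, zero_smul, add_zero]
  have hΦℓ : Φ ℓ = Polynomial.X := by rw [hΦ, hφ, one_smul, add_sub_cancel]
  have hmem : liftLin Φ (ℓ * f) ∈ p.map (Polynomial.C : MvPolynomial (Fin n) F →+* _) :=
    hp.liftLin_mem hΦK hf
  rw [map_mul, liftLin_coe, hΦℓ, Ideal.mem_map_C_iff] at hmem
  have hcoeff (m : ℕ) : (liftLin Φ f).coeff m ∈ p := by
    simpa only [Polynomial.coeff_X_mul] using hmem (m + 1)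
  have heval : Polynomial.eval (ℓ : MvPolynomial (Fin n) F) (liftLin Φ f) = f := by
    have hid : ((Polynomial.aeval (R := MvPolynomial (Fin n) F)
        (ℓ : MvPolynomial (Fin n) F)).restrictScalars F).comp (liftLin Φ) = AlgHom.id F _ :=
      algHom_ext_linForms fun x => by simp [liftLin_coe, hΦ, c]
    simpa [Polynomial.coe_aeval_eq_eval] using DFunLike.congr_fun hid f
  rw [← heval, Polynomial.eval_eq_sum_range]
  exact sum_mem fun m _ => p.mul_mem_right _ (hcoeff m)

theorem mem_of_formProd_mul_mem (hp : IsSupportedOn K p) {s : Finset ι} {ℓ : ι → LinForms F n}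
    (hℓ : ∀ j ∈ s, ℓ j ∉ K) {f : MvPolynomial (Fin n) F} (hf : formProd s ℓ * f ∈ p) :
    f ∈ p := by
  classical
  induction s using Finset.induction_on with
  | empty => simpa [formProd] using hf
  | insert j s hj ih =>
    rw [formProd, Finset.prod_insert hj, mul_assoc] at hf
    exact ih (fun i hi => hℓ i (Finset.mem_insert_of_mem hi))
      (hp.mem_of_coe_mul_mem (hℓ j (Finset.mem_insert_self j s)) hf)

end IsSupportedOn

end SupportedIdeals

section Separation

variable {F : Type*} [Field F] {n d : ℕ} {ι κ : Type*}
  {K K' : Submodule F (LinForms F n)} {p : Ideal (MvPolynomial (Fin n) F)}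

theorem mem_sup_span_mul_of_mem_of_mem {A : Type*} [CommRing A] {p : Ideal A} {v w x : A}
    (hw : ∀ y, w * y ∈ p ⊔ Ideal.span {v} → y ∈ p ⊔ Ideal.span {v})
    (hxv : x ∈ p ⊔ Ideal.span {v}) (hxw : x ∈ p ⊔ Ideal.span {w}) :
    x ∈ p ⊔ Ideal.span {v * w} := by
  obtain ⟨a, ha, _, hy, rfl⟩ := Submodule.mem_sup.mp hxw
  obtain ⟨y, rfl⟩ := Ideal.mem_span_singleton.mp hy
  have hwy : w * y ∈ p ⊔ Ideal.span {v} :=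
    (Submodule.add_mem_iff_right _ (Submodule.mem_sup_left ha)).mp hxv
  obtain ⟨b, hb, _, hz, rfl⟩ := Submodule.mem_sup.mp (hw y hwy)
  obtain ⟨z, rfl⟩ := Ideal.mem_span_singleton.mp hz
  exact Submodule.mem_sup.mpr ⟨a + w * b, add_mem ha (p.mul_mem_left w hb), v * w * z,
    Ideal.mem_span_singleton.mpr ⟨z, rfl⟩, by ring⟩

/-- Chinese remaindering: sorting the forms by their directions modulo `K` factors the product into
parts that are pairwise coprime modulo `p`, each supported on one form more than `K`. -/
theorem IsSupportedOn.exists_subset_notMem (hp : IsSupportedOn K p) (s : Finset ι)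
    (ℓ : ι → LinForms F n) {D : MvPolynomial (Fin n) F}
    (hD : D ∉ p ⊔ Ideal.span {formProd s ℓ}) :
    ∃ t ⊆ s, ∃ K', K ≤ K' ∧ Module.finrank F K' ≤ Module.finrank F K + 1 ∧
      (∀ j ∈ t, ℓ j ∈ K') ∧ D ∉ p ⊔ Ideal.span {formProd t ℓ} := by
  classical
  induction s using Finset.strongInduction with
  | H s ih =>
  obtain rfl | ⟨j, hj⟩ := s.eq_empty_or_nonempty
  · exact ⟨∅, subset_rfl, K, le_rfl, Nat.le_succ _, by simp, hD⟩
  let K' := K ⊔ Submodule.span F {ℓ j}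
  have hjK' : ℓ j ∈ K' := Submodule.mem_sup_right (Submodule.mem_span_singleton_self _)
  by_cases hin : D ∈ p ⊔ Ideal.span {formProd {i ∈ s | ℓ i ∈ K'} ℓ}
  · have hout : D ∉ p ⊔ Ideal.span {formProd {i ∈ s | ℓ i ∉ K'} ℓ} := fun hout => by
      have hsup := (hp.mono (le_sup_left : K ≤ K')).sup_span_formProd
        (s := {i ∈ s | ℓ i ∈ K'}) fun i hi => (Finset.mem_filter.mp hi).2
      refine hD ?_
      rw [← formProd_filter_mul_filter_not s (fun i => ℓ i ∈ K')]
      exact mem_sup_span_mul_of_mem_of_mem (fun y hy =>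
        hsup.mem_of_formProd_mul_mem (fun i hi => (Finset.mem_filter.mp hi).2) hy) hin hout
    obtain ⟨t, ht, h⟩ := ih {i ∈ s | ℓ i ∉ K'}
      (Finset.filter_ssubset.mpr ⟨j, hj, not_not.mpr hjK'⟩) hout
    exact ⟨t, ht.trans (Finset.filter_subset _ s), h⟩
  · refine ⟨{i ∈ s | ℓ i ∈ K'}, Finset.filter_subset _ s, K', le_sup_left, ?_,
      fun i hi => (Finset.mem_filter.mp hi).2, hin⟩
    refine (Submodule.finrank_add_le_finrank_add_finrank K _).trans ?_
    gcongr
    exact (finrank_span_le_card _).trans (by simp)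

theorem IsSupportedOn.mem_span_singleton_sup_of_mem_sup_span (hp : IsSupportedOn K p)
    {D P : MvPolynomial (Fin n) F} (hD : D.IsHomogeneous d) (hP : P.IsHomogeneous d) (hDp : D ∉ p)
    (h : D ∈ p ⊔ Ideal.span {P}) : P ∈ Submodule.span F {D} ⊔ p.restrictScalars F := by
  obtain ⟨a, ha, _, hy, hay⟩ := Submodule.mem_sup.mp h
  obtain ⟨f, rfl⟩ := Ideal.mem_span_singleton.mp hy
  have hdeg : homogeneousComponent d a + f.coeff 0 • P = D := by
    rw [← homogeneousComponent_mul_eq_smul hP, ← map_add, hay, homogeneousComponent_eq_self hD]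
  have had : homogeneousComponent d a ∈ p := hp.homogeneousComponent_mem ha d
  have hf : f.coeff 0 ≠ 0 := fun h0 => hDp (by rwa [← hdeg, h0, zero_smul, add_zero])
  rw [← Submodule.smul_mem_iff _ hf, ← sub_eq_of_eq_add' hdeg.symm]
  exact sub_mem (Submodule.mem_sup_left (Submodule.mem_span_singleton_self D))
    (Submodule.mem_sup_right had)

/-- The ideal `p`, supported on `K`, cuts `W` in a hyperplane of `W` that does not contain `D`. -/
structure Separates (K : Submodule F (LinForms F n)) (p : Ideal (MvPolynomial (Fin n) F))
    (W : Submodule F (MvPolynomial (Fin n) F)) (D : MvPolynomial (Fin n) F) : Prop where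
  supported : IsSupportedOn K p
  notMem : D ∉ p
  le_sup : W ≤ Submodule.span F {D} ⊔ p.restrictScalars F

theorem Separates.mono_left {W : Submodule F (MvPolynomial (Fin n) F)} {D : MvPolynomial (Fin n) F}
    (h : Separates K p W D) (hK : K ≤ K') : Separates K' p W D :=
  ⟨h.supported.mono hK, h.notMem, h.le_sup⟩

theorem Separates.exists_sup_span_formProd {W : Submodule F (MvPolynomial (Fin n) F)}
    {D : MvPolynomial (Fin n) F} (h : Separates K p W D) (s : Finset ι) (ℓ : ι → LinForms F n)
    (hD : D.IsHomogeneous s.card) :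
    ∃ (K' : Submodule F (LinForms F n)) (p' : Ideal (MvPolynomial (Fin n) F)),
      Module.finrank F K' ≤ Module.finrank F K + 1 ∧
      Separates K' p' (W ⊔ Submodule.span F {formProd s ℓ}) D := by
  by_cases hDs : D ∈ p ⊔ Ideal.span {formProd s ℓ}
  · refine ⟨K, p, Nat.le_succ _, h.supported, h.notMem, sup_le h.le_sup ?_⟩
    exact (Submodule.span_singleton_le_iff_mem _ _).mpr <|
      h.supported.mem_span_singleton_sup_of_mem_sup_span hD (formProd_isHomogeneous s ℓ)
        h.notMem hDs
  · obtain ⟨t, hts, K', hKK', hK', ht, hDt⟩ := h.supported.exists_subset_notMem s ℓ hDs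
    have hle : p ≤ p ⊔ Ideal.span {formProd t ℓ} := le_sup_left
    refine ⟨K', p ⊔ Ideal.span {formProd t ℓ}, hK',
      (h.supported.mono hKK').sup_span_formProd ht, hDt, sup_le ?_ ?_⟩
    · exact h.le_sup.trans (sup_le_sup_left (fun x hx => hle hx) _)
    · refine (Submodule.span_singleton_le_iff_mem _ _).mpr (Submodule.mem_sup_right ?_)
      exact Submodule.mem_sup_right
        (Ideal.mem_span_singleton.mpr (Finset.prod_dvd_prod_of_subset _ _ _ hts))

theorem exists_separates [Fintype ι] (S : Finset κ) (ℓ : κ → ι → LinForms F n)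
    {D : MvPolynomial (Fin n) F} (hD : D.IsHomogeneous (Fintype.card ι)) (hD0 : D ≠ 0) :
    ∃ (K : Submodule F (LinForms F n)) (p : Ideal (MvPolynomial (Fin n) F)),
      Module.finrank F K ≤ S.card ∧
      Separates K p (Submodule.span F ((fun i => formProd Finset.univ (ℓ i)) '' S)) D := by
  classical
  induction S using Finset.induction_on with
  | empty => exact ⟨⊥, ⊥, by simp, .bot, by simpa using hD0, by simp⟩
  | insert i S hi ih =>
    obtain ⟨K, p, hK, h⟩ := ih
    obtain ⟨K', p', hK', h'⟩ := h.exists_sup_span_formProd Finset.univ (ℓ i) hD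
    refine ⟨K', p', by rw [Finset.card_insert_of_notMem hi]; omega, ?_⟩
    rwa [Finset.coe_insert, Set.image_insert_eq, Submodule.span_insert, sup_comm]

theorem span_formProd_le_homogeneousSubmodule [Fintype ι] (ℓ : κ → ι → LinForms F n) :
    Submodule.span F (Set.range fun i => formProd Finset.univ (ℓ i)) ≤
      homogeneousSubmodule (Fin n) F (Fintype.card ι) := by
  rw [Submodule.span_le]
  rintro _ ⟨i, rfl⟩
  exact formProd_isHomogeneous _ _

/-- Each of the at most `finrank U` steps uses up one separated element of `U`, at the cost of one
linear form per product. -/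
theorem exists_forall_separates [Fintype ι] [Fintype κ] (ℓ : κ → ι → LinForms F n)
    {W : Submodule F (MvPolynomial (Fin n) F)}
    (hW : W = Submodule.span F (Set.range fun i => formProd Finset.univ (ℓ i)))
    (U : Submodule F (MvPolynomial (Fin n) F)) (hU : U ≤ W) :
    ∃ K : Submodule F (LinForms F n),
      Module.finrank F K ≤ Module.finrank F U * Fintype.card κ ∧
        ∀ D ∈ U, D ≠ 0 → ∃ p, Separates K p W D := by
  induction hr : Module.finrank F U using Nat.strong_induction_on generalizing U with
  | _ r ih =>
  obtain rfl | hbot := eq_or_ne U ⊥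
  · exact ⟨⊥, by simp, fun D hD hD0 => absurd hD hD0⟩
  obtain ⟨D₀, hD₀, hD₀0⟩ := Submodule.exists_mem_ne_zero_of_ne_bot hbot
  have hhom : D₀.IsHomogeneous (Fintype.card ι) :=
    span_formProd_le_homogeneousSubmodule ℓ (hW ▸ hU hD₀)
  obtain ⟨K₀, p, hK₀, h₀⟩ := exists_separates Finset.univ ℓ hhom hD₀0
  rw [Finset.coe_univ, Set.image_univ, ← hW] at h₀
  have : FiniteDimensional F W := hW ▸ FiniteDimensional.span_of_finite F (Set.finite_range _)
  have : FiniteDimensional F U := Submodule.finiteDimensional_of_le hU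
  have hlt : U ⊓ p.restrictScalars F < U :=
    lt_of_le_of_ne inf_le_left fun h => h₀.notMem (h.ge hD₀).2
  have hrk := Submodule.finrank_lt_finrank_of_lt hlt
  obtain ⟨K₁, hK₁, h₁⟩ := ih _ (hr ▸ hrk) _ (inf_le_left.trans hU) rfl
  refine ⟨K₀ ⊔ K₁, ?_, fun D hD hD0 => ?_⟩
  · calc Module.finrank F ↥(K₀ ⊔ K₁)
        ≤ Module.finrank F K₀ + Module.finrank F K₁ :=
          Submodule.finrank_add_le_finrank_add_finrank K₀ K₁
      _ ≤ (1 + Module.finrank F ↥(U ⊓ p.restrictScalars F)) * Fintype.card κ := by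
          rw [add_mul, one_mul]
          exact add_le_add hK₀ hK₁
      _ ≤ r * Fintype.card κ := Nat.mul_le_mul_right _ (by omega)
  · by_cases hDp : D ∈ p
    · obtain ⟨p', h⟩ := h₁ D ⟨hD, hDp⟩ hD0
      exact ⟨p', h.mono_left le_sup_right⟩
    · exact ⟨p, h₀.supported.mono le_sup_left, hDp,
        le_span_singleton_sup_of_mem h₀.le_sup (hU hD) hDp⟩

end Separation

section LeadingPart

variable {F : Type*} [Field F] {n : ℕ} {ι : Type*} [Fintype ι] {K : Submodule F (LinForms F n)}
  {p : Ideal (MvPolynomial (Fin n) F)} {q : LinForms F n →ₗ[F] LinForms F n}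
  {ℓ ℓ' : ι → LinForms F n} {γ : F}

open Classical in
/-- The product of those forms (with multiplicity) of the family `ℓ` that lie in `K`; for the forms
of a term of a circuit this is `Circuit.nucleusTerm`. -/
def innerProd (K : Submodule F (LinForms F n)) (ℓ : ι → LinForms F n) : MvPolynomial (Fin n) F :=
  formProd {j ∈ Finset.univ | ℓ j ∈ K} ℓ

open Classical in
/-- The number of forms (with multiplicity) of the family `ℓ` that lie outside `K`. -/
def outerCard (K : Submodule F (LinForms F n)) (ℓ : ι → LinForms F n) : ℕ :=
  Finset.card {j ∈ Finset.univ | ℓ j ∉ K}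

open Classical in
/-- The product of the images under `q` of those forms (with multiplicity) of the family `ℓ` that
are not killed by `q`. -/
def outerProd (q : LinForms F n →ₗ[F] LinForms F n) (ℓ : ι → LinForms F n) :
    MvPolynomial (Fin n) F :=
  formProd {j ∈ Finset.univ | ℓ j ∉ LinearMap.ker q} (q ∘ ℓ)

theorem innerProd_dvd_formProd (K : Submodule F (LinForms F n)) (ℓ : ι → LinForms F n) :
    innerProd K ℓ ∣ formProd Finset.univ ℓ :=
  Finset.prod_dvd_prod_of_subset _ _ _ (Finset.subset_univ _)

theorem outerProd_isHomogeneous (q : LinForms F n →ₗ[F] LinForms F n) (ℓ : ι → LinForms F n) :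
    (outerProd q ℓ).IsHomogeneous (outerCard (LinearMap.ker q) ℓ) :=
  formProd_isHomogeneous _ _

theorem outerProd_ne_zero (q : LinForms F n →ₗ[F] LinForms F n) (ℓ : ι → LinForms F n) :
    outerProd q ℓ ≠ 0 := by
  classical exact formProd_ne_zero fun _ hj => (Finset.mem_filter.mp hj).2

theorem exists_coeff_outerProd_ne_zero (q : LinForms F n →ₗ[F] LinForms F n)
    (ℓ : ι → LinForms F n) :
    ∃ m, m.degree = outerCard (LinearMap.ker q) ℓ ∧ (outerProd q ℓ).coeff m ≠ 0 := by
  obtain ⟨m, hm⟩ := ne_zero_iff.mp (outerProd_ne_zero q ℓ)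
  refine ⟨m, ?_, hm⟩
  rw [Finsupp.degree_eq_weight_one]
  exact outerProd_isHomogeneous q ℓ hm

/-- The substitution that puts the image under `q` of each linear form into a second set of
variables. The coefficients of the result are polynomials in the original variables. -/
def splitOff (q : LinForms F n →ₗ[F] LinForms F n) :
    MvPolynomial (Fin n) F →ₐ[F] MvPolynomial (Fin n) (MvPolynomial (Fin n) F) :=
  liftLin ((IsScalarTower.toAlgHom F (MvPolynomial (Fin n) F) _).toLinearMap ∘ₗ
      Submodule.subtype _ ∘ₗ (LinearMap.id - q) +
    (mapAlgHom (Algebra.ofId F (MvPolynomial (Fin n) F))).toLinearMap ∘ₗ Submodule.subtype _ ∘ₗ q)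

/-- The coefficient at the monomial `m` in the second set of variables of `splitOff q f`. -/
def splitCoeff (q : LinForms F n →ₗ[F] LinForms F n) (m : Fin n →₀ ℕ) :
    MvPolynomial (Fin n) F →ₗ[F] MvPolynomial (Fin n) F :=
  (lcoeff (MvPolynomial (Fin n) F) m).restrictScalars F ∘ₗ (splitOff q).toLinearMap

theorem splitOff_coe (q : LinForms F n →ₗ[F] LinForms F n) (x : LinForms F n) :
    splitOff q x = C ((x - q x : LinForms F n) : MvPolynomial (Fin n) F) +
      map (algebraMap F (MvPolynomial (Fin n) F)) (q x) :=
  liftLin_coe _ x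

theorem splitOff_coe_of_mem_ker {x : LinForms F n} (hx : x ∈ LinearMap.ker q) :
    splitOff q x = C (x : MvPolynomial (Fin n) F) := by
  rw [splitOff_coe, LinearMap.mem_ker.mp hx, sub_zero, ZeroMemClass.coe_zero, map_zero, add_zero]

theorem IsSupportedOn.splitCoeff_mem (hp : IsSupportedOn (LinearMap.ker q) p)
    {f : MvPolynomial (Fin n) F} (hf : f ∈ p) (m : Fin n →₀ ℕ) : splitCoeff q m f ∈ p := by
  have hmem : splitOff q f ∈ p.map (C : MvPolynomial (Fin n) F →+* _) :=
    hp.liftLin_mem (c := IsScalarTower.toAlgHom F (MvPolynomial (Fin n) F) _)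
      (fun x hx => (liftLin_coe _ x).symm.trans (splitOff_coe_of_mem_ker hx)) hf
  exact mem_map_C_iff.mp hmem m

open Classical in
theorem splitOff_formProd (q : LinForms F n →ₗ[F] LinForms F n) (ℓ : ι → LinForms F n) :
    splitOff q (formProd Finset.univ ℓ) = C (innerProd (LinearMap.ker q) ℓ) *
      ∏ j with ℓ j ∉ LinearMap.ker q, (C ((ℓ j - q (ℓ j) : LinForms F n) : MvPolynomial (Fin n) F) +
        map (algebraMap F (MvPolynomial (Fin n) F)) (q (ℓ j))) := by
  rw [← formProd_filter_mul_filter_not Finset.univ (fun j => ℓ j ∈ LinearMap.ker q), map_mul,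
    innerProd, formProd, formProd]
  simp only [map_prod, splitOff_coe]
  congr 1
  refine Finset.prod_congr rfl fun j hj => ?_
  rw [← splitOff_coe, splitOff_coe_of_mem_ker (Finset.mem_filter.mp hj).2]

theorem splitCoeff_formProd {m : Fin n →₀ ℕ} (hm : m.degree = outerCard (LinearMap.ker q) ℓ) :
    splitCoeff q m (formProd Finset.univ ℓ) =
      (outerProd q ℓ).coeff m • innerProd (LinearMap.ker q) ℓ := by
  classical
  have htop : ∀ P : MvPolynomial (Fin n) (MvPolynomial (Fin n) F), P.coeff m =
      (homogeneousComponent (outerCard (LinearMap.ker q) ℓ) P).coeff m := fun P => by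
    rw [coeff_homogeneousComponent, if_pos hm]
  change (splitOff q _).coeff m = _
  rw [splitOff_formProd, coeff_C_mul, htop, outerCard, homogeneousComponent_card_prod_C_add _ _
    fun j => (q (ℓ j)).2.map _, ← map_prod, coeff_map, mul_comm, ← Algebra.smul_def]
  rfl

theorem splitCoeff_formProd_eq_zero {m : Fin n →₀ ℕ}
    (hm : outerCard (LinearMap.ker q) ℓ < m.degree) :
    splitCoeff q m (formProd Finset.univ ℓ) = 0 := by
  classical
  change (splitOff q _).coeff m = _
  rw [splitOff_formProd, coeff_C_mul, coeff_eq_zero_of_totalDegree_lt, mul_zero]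
  exact (totalDegree_prod_C_add_le _ _ fun j => (q (ℓ j)).2.map _).trans_lt hm

theorem outerCard_le_of_sub_smul_mem (hp : IsSupportedOn (LinearMap.ker q) p)
    (hT : formProd Finset.univ ℓ ∉ p)
    (h : formProd Finset.univ ℓ - γ • formProd Finset.univ ℓ' ∈ p) :
    outerCard (LinearMap.ker q) ℓ ≤ outerCard (LinearMap.ker q) ℓ' := by
  by_contra! hlt
  obtain ⟨m, hm, hm0⟩ := exists_coeff_outerProd_ne_zero q ℓ
  have hmem := hp.splitCoeff_mem h m
  rw [map_sub, map_smul, splitCoeff_formProd hm, splitCoeff_formProd_eq_zero (hm ▸ hlt), smul_zero,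
    sub_zero, ← Submodule.restrictScalars_mem F, Submodule.smul_mem_iff _ hm0] at hmem
  exact hT (Ideal.mem_of_dvd p (innerProd_dvd_formProd _ ℓ) hmem)

/-- The leading part of each product in the new variables is its inner factor, in the original
variables, times its outer factor, in the new variables. As `p` lives in the original variables,
proportionality modulo `p` passes to the leading parts, and from there to the outer factors. -/
theorem exists_outerProd_eq_smul (hp : IsSupportedOn (LinearMap.ker q) p)
    (hT' : formProd Finset.univ ℓ' ∉ p)
    (hcard : outerCard (LinearMap.ker q) ℓ = outerCard (LinearMap.ker q) ℓ') (hγ : γ ≠ 0)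
    (h : formProd Finset.univ ℓ - γ • formProd Finset.univ ℓ' ∈ p) :
    ∃ c : F, c ≠ 0 ∧ outerProd q ℓ' = c • outerProd q ℓ := by
  let mk := Ideal.Quotient.mkₐ F p
  have hcoeff (m : Fin n →₀ ℕ) : (outerProd q ℓ).coeff m • mk (innerProd (LinearMap.ker q) ℓ) =
      (outerProd q ℓ').coeff m • mk (γ • innerProd (LinearMap.ker q) ℓ') := by
    by_cases hm : m.degree = outerCard (LinearMap.ker q) ℓ
    · have hmem := hp.splitCoeff_mem h m
      rw [map_sub, map_smul, splitCoeff_formProd hm, splitCoeff_formProd (hm.trans hcard),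
        smul_comm] at hmem
      rw [← map_smul, ← map_smul]
      exact (Ideal.Quotient.mk_eq_mk_iff_sub_mem _ _).mpr hmem
    · rw [(outerProd_isHomogeneous q ℓ).coeff_eq_zero hm,
        (outerProd_isHomogeneous q ℓ').coeff_eq_zero (hcard ▸ hm), zero_smul, zero_smul]
  have hne : mk (γ • innerProd (LinearMap.ker q) ℓ') ≠ 0 := fun h0 => by
    rw [map_smul, smul_eq_zero_iff_right hγ] at h0
    exact hT' (Ideal.mem_of_dvd p (innerProd_dvd_formProd _ ℓ')
      (Ideal.Quotient.eq_zero_iff_mem.mp h0))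
  obtain ⟨c, hc⟩ := exists_smul_eq_of_smul_eq_smul hne hcoeff
    fun h0 => outerProd_ne_zero q ℓ (MvPolynomial.ext _ _ (congrFun h0))
  have hc' : outerProd q ℓ' = c • outerProd q ℓ := MvPolynomial.ext _ _ fun m => by
    rw [coeff_smul]
    exact congrFun hc m
  refine ⟨c, ?_, hc'⟩
  rintro rfl
  exact outerProd_ne_zero q ℓ' (by rw [hc', zero_smul])

theorem exists_isMatching_of_outerProd_eq_smul {c : F} (hc : c ≠ 0)
    (h : outerProd q ℓ' = c • outerProd q ℓ) : ∃ π, IsMatching (LinearMap.ker q) ℓ ℓ' π := by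
  classical
  have hsub (f : ι → LinForms F n) : outerProd q f =
      ∏ j : {j // f j ∉ LinearMap.ker q}, (q (f j) : MvPolynomial (Fin n) F) :=
    Finset.prod_subtype _ (by simp) _
  have hirr (f : ι → LinForms F n) (j : {j // f j ∉ LinearMap.ker q}) :
      Irreducible (q (f j) : MvPolynomial (Fin n) F) := irreducible_coe_of_ne_zero j.2
  have hassoc : Associated (outerProd q ℓ) (outerProd q ℓ') := by
    rw [h, MvPolynomial.smul_eq_C_mul]
    exact (associated_unit_mul_right _ _ ((isUnit_iff_ne_zero.mpr hc).map C))
  rw [hsub, hsub] at hassoc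
  obtain ⟨e, he⟩ := exists_equiv_associated (hirr ℓ) (hirr ℓ') hassoc
  refine ⟨e.extendSubtype, fun j => ?_⟩
  by_cases hj : ℓ j ∈ LinearMap.ker q
  · exact proportionalMod_of_mem hj (not_not.mp (e.extendSubtype_not_mem j (not_not.mpr hj)))
  · rw [e.extendSubtype_apply_of_mem j hj]
    obtain ⟨a, ha, hae⟩ := exists_smul_eq_of_associated_coe (he ⟨j, hj⟩)
    refine ⟨a, ha, ℓ' (e ⟨j, hj⟩) - a • ℓ j, ?_, (add_sub_cancel _ _).symm⟩
    rw [LinearMap.mem_ker, map_sub, map_smul, hae, sub_self]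

theorem IsSupportedOn.exists_isMatching (hp : IsSupportedOn K p)
    (hT : formProd Finset.univ ℓ ∉ p) (hT' : formProd Finset.univ ℓ' ∉ p)
    (h : formProd Finset.univ ℓ - γ • formProd Finset.univ ℓ' ∈ p) :
    ∃ π, IsMatching K ℓ ℓ' π := by
  obtain ⟨q, rfl⟩ := exists_endomorphism_ker_eq K
  have hγ : γ ≠ 0 := by
    rintro rfl
    exact hT (by rwa [zero_smul, sub_zero] at h)
  have h' : formProd Finset.univ ℓ' - γ⁻¹ • formProd Finset.univ ℓ ∈ p := by
    rw [← neg_mem_iff, neg_sub, ← Submodule.restrictScalars_mem F, ← Submodule.smul_mem_iff _ hγ,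
      smul_sub, smul_inv_smul₀ hγ]
    exact h
  obtain ⟨c, hc, hcℓ⟩ := exists_outerProd_eq_smul hp hT'
    ((outerCard_le_of_sub_smul_mem hp hT h).antisymm (outerCard_le_of_sub_smul_mem hp hT' h')) hγ h
  exact exists_isMatching_of_outerProd_eq_smul hc hcℓ

end LeadingPart

section Nucleus

variable {F : Type*} [Field F] {n k d : ℕ} {ι : Type*} [Fintype ι] {K : Submodule F (LinForms F n)}
  {p : Ideal (MvPolynomial (Fin n) F)} {q : LinForms F n →ₗ[F] LinForms F n}
  {ℓ ℓ' : ι → LinForms F n}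

theorem IsMatching.outerCard_eq {π : ι ≃ ι} (h : IsMatching K ℓ ℓ' π) :
    outerCard K ℓ' = outerCard K ℓ := by
  classical
  refine (Finset.card_equiv π fun i => ?_).symm
  simpa using (mem_iff_of_proportionalMod (h i)).not

theorem IsMatching.exists_outerProd_eq_smul {π : ι ≃ ι}
    (h : IsMatching (LinearMap.ker q) ℓ ℓ' π) :
    ∃ c : F, c ≠ 0 ∧ outerProd q ℓ' = c • outerProd q ℓ := by
  classical
  have hmem (i : ι) := mem_iff_of_proportionalMod (h i)
  choose c hc v hv hcv using h
  refine ⟨∏ i with ℓ i ∉ LinearMap.ker q, c i, Finset.prod_ne_zero_iff.mpr fun i _ => hc i, ?_⟩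
  rw [outerProd, outerProd, formProd, formProd, ← Finset.prod_smul]
  refine (Finset.prod_equiv π (fun i => by simpa using (hmem i).not) fun i _ => ?_).symm
  rw [Function.comp_apply, Function.comp_apply, hcv, map_add, LinearMap.mem_ker.mp (hv i),
    add_zero, map_smul, Submodule.coe_smul]

theorem Separates.exists_isMatching {W : Submodule F (MvPolynomial (Fin n) F)}
    {D : MvPolynomial (Fin n) F} (h : Separates K p W D) (hW : formProd Finset.univ ℓ ∈ W)
    (hW' : formProd Finset.univ ℓ' ∈ W) (hT : formProd Finset.univ ℓ ∉ p)
    (hT' : formProd Finset.univ ℓ' ∉ p) : ∃ π, IsMatching K ℓ ℓ' π := by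
  obtain ⟨_, hx, y, hy, hxy⟩ :=
    Submodule.mem_sup.mp (le_span_singleton_sup_of_mem h.le_sup hW' hT' hW)
  obtain ⟨γ, rfl⟩ := Submodule.mem_span_singleton.mp hx
  exact h.supported.exists_isMatching hT hT' (sub_eq_of_eq_add' hxy.symm ▸ hy)

namespace Circuit

variable (C : Circuit F n k d)

theorem term_eq_smul (i : Fin k) : C.term i = C.coeff i • formProd Finset.univ (C.form i) := by
  rw [MvPolynomial.smul_eq_C_mul]
  rfl

theorem nucleusTerm_eq_innerProd (K : Submodule F (LinForms F n)) (i : Fin k) :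
    C.nucleusTerm K i = innerProd K (C.form i) :=
  rfl

theorem formProd_mem_iff_term_mem {A : Submodule F (MvPolynomial (Fin n) F)} {i : Fin k} :
    formProd Finset.univ (C.form i) ∈ A ↔ C.term i ∈ A := by
  rw [term_eq_smul, Submodule.smul_mem_iff _ (C.coeff_ne_zero i)]

theorem span_range_term : Submodule.span F (Set.range C.term) =
    Submodule.span F (Set.range fun i => formProd Finset.univ (C.form i)) := by
  refine le_antisymm (Submodule.span_le.mpr ?_) (Submodule.span_le.mpr ?_)
  · rintro _ ⟨i, rfl⟩
    exact C.formProd_mem_iff_term_mem.mp (Submodule.subset_span ⟨i, rfl⟩)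
  · rintro _ ⟨i, rfl⟩
    exact C.formProd_mem_iff_term_mem.mpr (Submodule.subset_span ⟨i, rfl⟩)

theorem nucleusTerm_dvd_term (K : Submodule F (LinForms F n)) (i : Fin k) :
    C.nucleusTerm K i ∣ C.term i :=
  (innerProd_dvd_formProd K (C.form i)).mul_left _

variable {C}

theorem IsStronglyMinimal.exists_linearIndepOn_ne [NeZero k] (h : C.IsStronglyMinimal) :
    ∃ l, LinearIndepOn F C.term {i | i ≠ l} := by
  have hk := NeZero.pos k
  refine ⟨⟨k - 1, by omega⟩, h.mono fun i hi => ?_⟩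
  have hi' : (i : ℕ) ≠ k - 1 := fun h => hi (Fin.ext h)
  exact Set.mem_ofPred.mpr (by omega)

variable [NeZero k]

/-- The lists of forms of all terms of `C` are matched modulo `K`: the second requirement on a
nucleus. -/
def IsMatchedMod (C : Circuit F n k d) (K : Submodule F (LinForms F n)) : Prop :=
  ∀ i, ∃ π : Fin d ≃ Fin d, IsMatching K (C.form 0) (C.form i) π

/-- Two terms outside an ideal that separates a sum of terms are proportional modulo that ideal,
hence matched. So the sum over a class of matched terms vanishes. -/
theorem isMatchedMod_of_forall_separates (hzero : C.IsIdentity) (hu : NoProperZeroSubsum C.term)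
    (hK : ∀ D ∈ Submodule.span F (Set.range C.term), D ≠ 0 →
      ∃ p, Separates K p (Submodule.span F (Set.range C.term)) D) : C.IsMatchedMod K := by
  classical
  let S : Finset (Fin k) := {i | ∃ π : Fin d ≃ Fin d, IsMatching K (C.form 0) (C.form i) π}
  have hterm (i : Fin k) : C.term i ∈ Submodule.span F (Set.range C.term) :=
    Submodule.subset_span ⟨i, rfl⟩
  have hSsum : ∑ i ∈ S, C.term i = 0 := by
    by_contra hD0
    obtain ⟨p, hp⟩ := hK _ (sum_mem fun i _ => hterm i) hD0
    obtain ⟨i, hiS, hi⟩ : ∃ i ∈ S, C.term i ∉ p := by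
      by_contra! h
      exact hp.notMem (sum_mem h)
    obtain ⟨j, hjS, hj⟩ : ∃ j ∈ Sᶜ, C.term j ∉ p := by
      by_contra! h
      have hneg := eq_neg_of_add_eq_zero_left ((Finset.sum_add_sum_compl S C.term).trans hzero)
      exact hp.notMem (hneg ▸ neg_mem (sum_mem h))
    obtain ⟨π, hπ⟩ := (Finset.mem_filter.mp hiS).2
    obtain ⟨ρ, hρ⟩ := hp.exists_isMatching (C.formProd_mem_iff_term_mem.mpr (hterm i))
      (C.formProd_mem_iff_term_mem.mpr (hterm j))
      (mt (C.formProd_mem_iff_term_mem (A := p.restrictScalars F)).mp hi)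
      (mt (C.formProd_mem_iff_term_mem (A := p.restrictScalars F)).mp hj)
    exact Finset.mem_compl.mp hjS <| Finset.mem_filter.mpr ⟨Finset.mem_univ j, π.trans ρ,
      fun a => (proportionalMod K).trans (hπ a) (hρ (π a))⟩
  have hS0 : (0 : Fin k) ∈ S :=
    Finset.mem_filter.mpr ⟨Finset.mem_univ 0, Equiv.refl _, fun _ => (proportionalMod K).refl _⟩
  intro i
  have hi : i ∈ S := hu S hSsum ⟨0, hS0⟩ ▸ Finset.mem_univ i
  exact (Finset.mem_filter.mp hi).2

theorem IsMatchedMod.exists_linearMap_term_eq_smul (h : C.IsMatchedMod K) :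
    ∃ (L : MvPolynomial (Fin n) F →ₗ[F] MvPolynomial (Fin n) F) (δ : Fin k → F),
      (∀ i, δ i ≠ 0) ∧ (∀ i, L (C.term i) = δ i • C.nucleusTerm K i) ∧
      ∀ p, IsSupportedOn K p → ∀ f ∈ p, L f ∈ p := by
  obtain ⟨q, rfl⟩ := exists_endomorphism_ker_eq K
  obtain ⟨m, hm, hm0⟩ := exists_coeff_outerProd_ne_zero q (C.form 0)
  choose π hπ using h
  choose c hc hcq using fun i => (hπ i).exists_outerProd_eq_smul
  refine ⟨splitCoeff q m, fun i => C.coeff i * (c i * (outerProd q (C.form 0)).coeff m),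
    fun i => mul_ne_zero (C.coeff_ne_zero i) (mul_ne_zero (hc i) hm0), fun i => ?_,
    fun p hp f hf => hp.splitCoeff_mem hf m⟩
  rw [term_eq_smul, map_smul, splitCoeff_formProd (hm.trans (hπ i).outerCard_eq.symm), hcq,
    coeff_smul, smul_smul]
  rfl

theorem IsMatchedMod.exists_sum_smul_nucleusTerm_eq_zero (h : C.IsMatchedMod K)
    (hzero : C.IsIdentity) :
    ∃ δ : Fin k → F, (∀ i, δ i ≠ 0) ∧ ∑ i, δ i • C.nucleusTerm K i = 0 := by
  obtain ⟨L, δ, hδ, hL, -⟩ := h.exists_linearMap_term_eq_smul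
  refine ⟨δ, hδ, ?_⟩
  simp only [← hL]
  rw [← map_sum, hzero, map_zero]

theorem IsMatchedMod.linearIndepOn_nucleusTerm {I : Set (Fin k)} (h : C.IsMatchedMod K)
    (hI : LinearIndepOn F C.term I)
    (hK : ∀ D ∈ Submodule.span F (Set.range C.term), D ≠ 0 →
      ∃ p, Separates K p (Submodule.span F (Set.range C.term)) D) :
    LinearIndepOn F (C.nucleusTerm K) I := by
  obtain ⟨L, δ, hδ, hL, hLp⟩ := h.exists_linearMap_term_eq_smul
  have hker (D) (hD : D ∈ Submodule.span F (Set.range C.term)) (hLD : L D = 0) : D = 0 := by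
    by_contra hD0
    obtain ⟨p, hp⟩ := hK D hD hD0
    have hterm (i : Fin k) : C.term i ∈ p := by
      obtain ⟨_, hx, y, hy, hxy⟩ :=
        Submodule.mem_sup.mp (hp.le_sup (Submodule.subset_span ⟨i, rfl⟩))
      obtain ⟨γ, rfl⟩ := Submodule.mem_span_singleton.mp hx
      have hLi : δ i • C.nucleusTerm K i ∈ p.restrictScalars F := by
        rw [← hL, ← hxy, map_add, map_smul, hLD, smul_zero, zero_add]
        exact hLp p hp.supported y hy
      exact p.mem_of_dvd (C.nucleusTerm_dvd_term K i)
        ((Submodule.smul_mem_iff (p.restrictScalars F) (hδ i)).mp hLi)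
    have hle : Submodule.span F (Set.range C.term) ≤ p.restrictScalars F :=
      Submodule.span_le.mpr (by rintro _ ⟨i, rfl⟩; exact hterm i)
    exact hp.notMem (hle hD)
  have hinj : Set.InjOn L (Submodule.span F (C.term '' I)) := by
    intro x hx y hy hxy
    have hle := Submodule.span_mono (R := F) (Set.image_subset_range C.term I)
    exact sub_eq_zero.mp (hker _ (sub_mem (hle hx) (hle hy)) (by rw [map_sub, hxy, sub_self]))
  rw [← linearIndepOn_smul_iff hδ]
  simpa only [Function.comp_def, hL] using hI.map_injOn L hinj

theorem exists_isNucleus (hzero : C.IsIdentity) (hmin : C.IsStronglyMinimal) {I : Set (Fin k)}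
    (hI : LinearIndepOn F C.term I) : ∃ K, C.IsNucleus I K := by
  obtain ⟨l, hl⟩ := hmin.exists_linearIndepOn_ne
  obtain ⟨K, hK, hsep⟩ := exists_forall_separates C.form C.span_range_term _ le_rfl
  have hmatch := isMatchedMod_of_forall_separates hzero
    (noProperZeroSubsum_of_linearIndepOn_ne hl hzero) hsep
  refine ⟨K, ?_, hmatch, hmatch.linearIndepOn_nucleusTerm hI hsep⟩
  calc Module.finrank F K
      ≤ Module.finrank F (Submodule.span F (Set.range C.term)) * Fintype.card (Fin k) := hK
    _ ≤ Fintype.card (Fin k) * Fintype.card (Fin k) :=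
        Nat.mul_le_mul_right _ (finrank_range_le_card C.term)
    _ < 2 * k ^ 2 := by
        have := NeZero.pos k
        rw [Fintype.card_fin]
        nlinarith

theorem exists_eq_ne_of_maximal (hzero : C.IsIdentity) (hmin : C.IsStronglyMinimal)
    {I : Set (Fin k)} (hI : Maximal (fun J : Set (Fin k) => LinearIndepOn F C.term J) I) :
    ∃ l, I = {i | i ≠ l} := by
  obtain ⟨l₀, hl₀⟩ := hmin.exists_linearIndepOn_ne
  obtain ⟨l, hl⟩ : ∃ l, l ∉ I := by
    by_contra! hall
    have huniv := linearIndepOn_iff'.mp hI.1 Finset.univ 1 (fun i _ => hall i)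
      (by simp only [Pi.one_apply, one_smul]; exact hzero)
    exact one_ne_zero (huniv l₀ (Finset.mem_univ _))
  exact ⟨l, hI.eq_of_le (linearIndepOn_ne_of_sum_eq_zero hl₀ hzero l)
    fun i hi => ne_of_mem_of_not_mem hi hl⟩

end Circuit

end Nucleus

section ElementaryTensors

variable {E ι σ Y : Type*} [Field E]

/-- The elements of an algebra that stabilize the linear subspace `V` under multiplication. -/
def stabilizerAlgebra {R A : Type*} [CommSemiring R] [CommSemiring A] [Algebra R A]
    (V : Submodule R A) : Subalgebra R A where
  carrier := {a | ∀ v ∈ V, a * v ∈ V}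
  mul_mem' ha hb v hv := by
    rw [mul_assoc]
    exact ha _ (hb v hv)
  add_mem' ha hb v hv := by
    rw [add_mul]
    exact V.add_mem (ha v hv) (hb v hv)
  algebraMap_mem' r v hv := by
    rw [← Algebra.smul_def]
    exact V.smul_mem r hv

theorem indicator_mem_subalgebra [Finite ι] (A : Subalgebra E (ι → E)) {h : Y → ι → E}
    (hA : ∀ y, h y ∈ A) (i₀ : ι) : {i | ∀ y, h y i = h y i₀}.indicator 1 ∈ A := by
  classical
  have := Fintype.ofFinite ι
  let T : Set ι := {i | ∀ y, h y i = h y i₀}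
  have hex (j : ι) : ∃ g ∈ A, g j = 0 ∧ ∀ i ∈ T, j ∉ T → g i = 1 := by
    by_cases hj : j ∈ T
    · exact ⟨0, A.zero_mem, rfl, fun _ _ h => absurd hj h⟩
    obtain ⟨y, hy⟩ := not_forall.mp hj
    refine ⟨(h y i₀ - h y j)⁻¹ • (h y - algebraMap E _ (h y j)),
      A.smul_mem (sub_mem (hA y) (A.algebraMap_mem _)) _, by simp, fun i hi _ => ?_⟩
    simpa [hi y] using inv_mul_cancel₀ (sub_ne_zero.mpr (Ne.symm hy))
  choose g hgA hg0 hg1 using hex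
  convert A.prod_mem (t := {j | j ∉ T}) fun j _ => hgA j using 1
  funext i
  rw [Finset.prod_apply]
  by_cases hi : i ∈ T
  · rw [Set.indicator_of_mem hi, Pi.one_apply,
      Finset.prod_eq_one fun j hj => hg1 j i hi (Finset.mem_filter.mp hj).2]
  · rw [Set.indicator_of_notMem hi]
    symm
    exact Finset.prod_eq_zero (i := i) (by simpa using hi) (hg0 i)

variable [Fintype ι]

/-- The linear relations `β` between the elementary tensors `⨂ x i s`, `s ∈ Q`, one for each `i`,
written in coordinates: a vector is a function on `Y`, and `α s` is the coordinate at the factor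
`s`. -/
def relationSpace (x : ι → σ → Y → E) (Q : Finset σ) : Submodule E (ι → E) where
  carrier := {β | ∀ α : σ → Y, ∑ i, β i * ∏ s ∈ Q, x i s (α s) = 0}
  add_mem' ha hb α := by
    simp only [Pi.add_apply, add_mul, Finset.sum_add_distrib]
    rw [ha α, hb α, add_zero]
  zero_mem' α := by simp
  smul_mem' c b hb α := by
    simp only [Pi.smul_apply, smul_eq_mul, mul_assoc, ← Finset.mul_sum]
    rw [hb α, mul_zero]

variable {x : ι → σ → Y → E} {Q Q' : Finset σ} {star : σ → Y} {u : ι → E}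

theorem relationSpace_anti (hstar : ∀ i s, x i s (star s) = 1) (hQ : Q ⊆ Q') :
    relationSpace x Q' ≤ relationSpace x Q := by
  classical
  intro β hβ α
  rw [← hβ fun s => if s ∈ Q then α s else star s]
  refine Finset.sum_congr rfl fun i _ => congrArg (β i * ·) ?_
  rw [← Finset.prod_subset hQ fun s _ hs => by rw [if_neg hs, hstar]]
  exact Finset.prod_congr rfl fun s hs => by rw [if_pos hs]

theorem sum_eq_zero_of_mem_relationSpace (hstar : ∀ i s, x i s (star s) = 1)
    (hu : u ∈ relationSpace x Q) : ∑ i, u i = 0 := by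
  simpa using relationSpace_anti hstar (Finset.empty_subset Q) hu star

theorem mem_stabilizerAlgebra_relationSpace [DecidableEq σ] {s : σ} (hs : s ∉ Q)
    (hle : relationSpace x Q ≤ relationSpace x (insert s Q)) (y : Y) :
    (fun i => x i s y) ∈ stabilizerAlgebra (relationSpace x Q) := by
  intro β hβ α
  rw [← hle hβ (Function.update α s y)]
  refine Finset.sum_congr rfl fun i _ => ?_
  rw [Finset.prod_insert hs, Function.update_self, Pi.mul_apply, mul_assoc, mul_left_comm]
  congr 2
  exact Finset.prod_congr rfl fun t ht => by
    rw [Function.update_of_ne (ne_of_mem_of_not_mem ht hs)]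

/-- If the factor `s` imposes no new condition on the relations, every relation restricts to the
classes of indices with the same factor at `s`. -/
theorem eq_of_relationSpace_le_insert [DecidableEq σ] (hstar : ∀ i s, x i s (star s) = 1) {s : σ}
    (hs : s ∉ Q) (hle : relationSpace x Q ≤ relationSpace x (insert s Q))
    (hu : u ∈ relationSpace x Q) (hmin : NoProperZeroSubsum u) (i j : ι) : x i s = x j s := by
  classical
  have hclass := sum_eq_zero_of_mem_relationSpace hstar (indicator_mem_subalgebra _
    (mem_stabilizerAlgebra_relationSpace hs hle) j u hu)
  have hsum : ∑ i with ∀ y, x i s y = x j s y, u i = 0 := by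
    simpa [Set.indicator_apply, Finset.sum_filter] using hclass
  have huniv := hmin _ hsum ⟨j, by simp⟩
  exact funext (Finset.filter_eq_self.mp huniv i (Finset.mem_univ i))

theorem exists_forall_eq_of_mem_relationSpace_univ [Fintype σ]
    (hstar : ∀ i s, x i s (star s) = 1) (hcard : Fintype.card ι ≤ Fintype.card σ + 1)
    (hu : u ∈ relationSpace x Finset.univ) (hu0 : u ≠ 0) (hmin : NoProperZeroSubsum u) :
    ∃ s, ∀ i j, x i s = x j s := by
  classical
  by_contra! hne
  have hrank (Q : Finset σ) :
      Module.finrank E (relationSpace x Q) + Q.card + 1 ≤ Fintype.card ι := by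
    induction Q using Finset.induction_on with
    | empty =>
      obtain ⟨i, -⟩ := Function.ne_iff.mp hu0
      have hne_top : relationSpace x ∅ ≠ ⊤ := fun htop => by
        have hmem : (Pi.single i 1 : ι → E) ∈ relationSpace x ∅ := htop ▸ Submodule.mem_top
        simpa using sum_eq_zero_of_mem_relationSpace hstar hmem
      simpa using Submodule.finrank_lt hne_top
    | insert s Q hs ih =>
      obtain ⟨i, j, hij⟩ := hne s
      have hlt : relationSpace x (insert s Q) < relationSpace x Q :=
        lt_of_le_not_ge (relationSpace_anti hstar (Finset.subset_insert s Q)) fun hle =>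
          hij <| eq_of_relationSpace_le_insert hstar hs hle
            (relationSpace_anti hstar (Finset.subset_univ Q) hu) hmin i j
      have := Submodule.finrank_lt_finrank_of_lt hlt
      rw [Finset.card_insert_of_notMem hs]
      omega
  have hbot : relationSpace x Finset.univ = ⊥ := by
    have := hrank Finset.univ
    rw [Finset.card_univ] at this
    exact Submodule.finrank_eq_zero.mp (by omega)
  exact hu0 (by rwa [hbot, Submodule.mem_bot] at hu)

theorem coeff_prod_aeval_X {A : Type*} [CommRing A] [Fintype σ] (f : σ → Polynomial A)
    (α : σ → ℕ) :
    (∏ s, Polynomial.aeval (X s : MvPolynomial σ A) (f s)).coeff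
      (Finsupp.equivFunOnFinite.symm α) = ∏ s, (f s).coeff (α s) := by
  classical
  have hX (s : σ) : Polynomial.aeval (X s : MvPolynomial σ A) (f s) =
      ∑ a ∈ Finset.range ((f s).natDegree + α s + 1), C ((f s).coeff a) * X s ^ a := by
    rw [Polynomial.aeval_def,
      Polynomial.eval₂_eq_sum_range' _ (n := (f s).natDegree + α s + 1) (by omega)]
    rfl
  have hmonomial (β : σ → ℕ) : ∏ s, (C ((f s).coeff (β s)) * X s ^ β s : MvPolynomial σ A) =
      monomial (Finsupp.equivFunOnFinite.symm β) (∏ s, (f s).coeff (β s)) := by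
    rw [monomial_eq, Finset.prod_mul_distrib, map_prod, Finsupp.prod_fintype _ _ (by simp)]
    rfl
  simp only [hX, Finset.prod_univ_sum, coeff_sum, hmonomial, coeff_monomial,
    EmbeddingLike.apply_eq_iff_eq]
  rw [Finset.sum_ite_eq', if_pos]
  exact Fintype.mem_piFinset.mpr fun s => Finset.mem_range.mpr (by omega)

theorem sum_eq_zero_of_sum_mul_prod_aeval_X_eq_zero {A : Type*} [CommRing A] [Fintype σ]
    {f : ι → σ → Polynomial A} {deg : σ → ℕ} (hmonic : ∀ i s, (f i s).Monic)
    (hdeg : ∀ i s, (f i s).natDegree = deg s) {u : ι → A}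
    (hrel : ∑ i, C (u i) * ∏ s, Polynomial.aeval (X s : MvPolynomial σ A) (f i s) = 0) :
    ∑ i, u i = 0 := by
  have hlead (i : ι) (s : σ) : (f i s).coeff (deg s) = 1 := hdeg i s ▸ (hmonic i s).coeff_natDegree
  simpa only [coeff_sum, coeff_C_mul, coeff_prod_aeval_X, hlead, Finset.prod_const_one, mul_one,
    coeff_zero] using congrArg (MvPolynomial.coeff (Finsupp.equivFunOnFinite.symm deg)) hrel

theorem exists_forall_eq_of_sum_mul_prod_aeval_X_eq_zero {A : Type*} [CommRing A] [IsDomain A]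
    [Fintype σ] {f : ι → σ → Polynomial A} {deg : σ → ℕ} (hmonic : ∀ i s, (f i s).Monic)
    (hdeg : ∀ i s, (f i s).natDegree = deg s) (hcard : Fintype.card ι ≤ Fintype.card σ + 1)
    {u : ι → A} (hu0 : u ≠ 0) (hmin : NoProperZeroSubsum u)
    (hrel : ∑ i, C (u i) * ∏ s, Polynomial.aeval (X s : MvPolynomial σ A) (f i s) = 0) :
    ∃ s, ∀ i j, f i s = f j s := by
  let φ : A →+* FractionRing A := algebraMap A (FractionRing A)
  have hφ : Function.Injective φ := IsFractionRing.injective A (FractionRing A)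
  have hmem : φ ∘ u ∈ relationSpace (fun i s m => φ ((f i s).coeff m)) Finset.univ := fun α => by
    have hcoeff := congrArg (φ ∘ MvPolynomial.coeff (Finsupp.equivFunOnFinite.symm α)) hrel
    simpa only [Function.comp_apply, coeff_sum, coeff_C_mul, coeff_prod_aeval_X, map_sum, map_mul,
      map_prod, coeff_zero, map_zero] using hcoeff
  obtain ⟨s, hs⟩ := exists_forall_eq_of_mem_relationSpace_univ (star := deg)
    (fun i s => by rw [← hdeg i s, (hmonic i s).coeff_natDegree, map_one]) hcard hmem
    (fun h => hu0 (funext fun i => hφ (by simpa using congrFun h i)))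
    fun S hS => hmin S (hφ (by simpa using hS))
  exact ⟨s, fun i j => Polynomial.ext fun m => hφ (congrFun (hs i j) m)⟩

end ElementaryTensors

section Directions

variable {F M : Type*} [Field F] [AddCommGroup M] [Module F M] {K : Submodule F M} {x y : M}

/-- A chosen representative of the class of `x` under `proportionalMod K`, that is, of the line
spanned by `x` modulo `K`. -/
def dirRep (K : Submodule F M) (x : M) : M :=
  (Quotient.mk (proportionalMod K) x).out

theorem proportionalMod_dirRep (K : Submodule F M) (x : M) : proportionalMod K x (dirRep K x) :=
  (proportionalMod K).symm (Quotient.mk_out (s := proportionalMod K) x)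

theorem dirRep_eq_dirRep_iff : dirRep K x = dirRep K y ↔ proportionalMod K x y :=
  Quotient.out_inj.trans Quotient.eq

theorem dirRep_eq_of_mkQ_dirRep_eq_smul {c : F} (hc : c ≠ 0)
    (h : K.mkQ (dirRep K y) = c • K.mkQ (dirRep K x)) : dirRep K y = dirRep K x := by
  rw [dirRep_eq_dirRep_iff]
  have hyx : dirRep K y - c • dirRep K x ∈ K := by
    rw [← map_smul] at h
    exact (Submodule.Quotient.eq K).mp h
  exact (proportionalMod K).symm <| (proportionalMod K).trans (proportionalMod_dirRep K x) <|
    (proportionalMod K).trans ⟨c, hc, _, hyx, (add_sub_cancel _ _).symm⟩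
      ((proportionalMod K).symm (proportionalMod_dirRep K y))

theorem injOn_mkQ_range_dirRep (K : Submodule F M) : Set.InjOn K.mkQ (Set.range (dirRep K)) := by
  rintro _ ⟨x, rfl⟩ _ ⟨y, rfl⟩ h
  exact dirRep_eq_of_mkQ_dirRep_eq_smul one_ne_zero (by rw [one_smul, h])

/-- The factor `c` of a multiple `c • x` that agrees with `dirRep K x` modulo `K`. -/
def dirScale (K : Submodule F M) (x : M) : F :=
  (proportionalMod_dirRep K x).choose

/-- The element of `K` by which `dirRep K x` differs from a nonzero multiple of `x`. -/
def dirOffset (K : Submodule F M) (x : M) : M :=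
  dirRep K x - dirScale K x • x

theorem dirScale_ne_zero (K : Submodule F M) (x : M) : dirScale K x ≠ 0 :=
  (proportionalMod_dirRep K x).choose_spec.1

theorem dirOffset_mem (K : Submodule F M) (x : M) : dirOffset K x ∈ K := by
  obtain ⟨v, hv, hxv⟩ := (proportionalMod_dirRep K x).choose_spec.2
  rw [dirOffset, dirScale, sub_eq_of_eq_add' hxv]
  exact hv

theorem dirScale_smul (K : Submodule F M) (x : M) :
    dirScale K x • x = dirRep K x - dirOffset K x :=
  (sub_sub_cancel _ _).symm

end Directions

section DirectionPolynomials

variable {F : Type*} [Field F] {n : ℕ} {ι : Type*} [Fintype ι] {K : Submodule F (LinForms F n)}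
  {T : Finset (LinForms F n)} {ℓ ℓ' : ι → LinForms F n}

open Classical in
/-- The product of those forms of the family `ℓ` that are proportional to `s` modulo `K`, each
scaled to be `s` up to an element of `K`, with `s` replaced by a variable. -/
def dirPoly (K : Submodule F (LinForms F n)) (s : LinForms F n) (ℓ : ι → LinForms F n) :
    Polynomial (MvPolynomial (Fin n) F) :=
  ∏ j with dirRep K (ℓ j) = s, (Polynomial.X - Polynomial.C (dirOffset K (ℓ j)).1)

theorem dirPoly_monic (K : Submodule F (LinForms F n)) (s : LinForms F n) (ℓ : ι → LinForms F n) :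
    (dirPoly K s ℓ).Monic :=
  Polynomial.monic_prod_X_sub_C _ _

theorem isRoot_dirPoly_iff {s : LinForms F n} {v : MvPolynomial (Fin n) F} :
    (dirPoly K s ℓ).IsRoot v ↔ ∃ j, dirRep K (ℓ j) = s ∧ dirOffset K (ℓ j) = v := by
  simp only [dirPoly, Polynomial.IsRoot.def, Polynomial.eval_prod, Finset.prod_eq_zero_iff,
    Finset.mem_filter_univ, Polynomial.eval_sub, Polynomial.eval_X, Polynomial.eval_C,
    sub_eq_zero, eq_comm (a := v)]

theorem IsMatching.natDegree_dirPoly_eq {π : ι ≃ ι} (h : IsMatching K ℓ ℓ' π) (s : LinForms F n) :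
    (dirPoly K s ℓ').natDegree = (dirPoly K s ℓ).natDegree := by
  classical
  simp only [dirPoly, Polynomial.natDegree_finsetProd_X_sub_C_eq_card]
  refine (Finset.card_equiv π fun j => ?_).symm
  rw [Finset.mem_filter_univ, Finset.mem_filter_univ, dirRep_eq_dirRep_iff.mpr (h j)]

theorem apply_eq_smul_aeval_X {Ψ : LinForms F n →ₗ[F] MvPolynomial T (MvPolynomial (Fin n) F)}
    (hΨK : ∀ x ∈ K, Ψ x = C (x : MvPolynomial (Fin n) F)) (hΨT : ∀ s : T, Ψ s = X s) {s : T}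
    {x : LinForms F n} (hx : dirRep K x = s) :
    Ψ x = (dirScale K x)⁻¹ • Polynomial.aeval (X s : MvPolynomial T (MvPolynomial (Fin n) F))
      (Polynomial.X - Polynomial.C (dirOffset K x).1) := by
  rw [eq_inv_smul_iff₀ (dirScale_ne_zero K x), ← map_smul, dirScale_smul, hx, map_sub, hΨT,
    hΨK _ (dirOffset_mem K x), map_sub, Polynomial.aeval_X, Polynomial.aeval_C]
  rfl

theorem notMem_of_linearIndepOn_mkQ (hT : LinearIndepOn F K.mkQ (T : Set (LinForms F n)))
    {s : LinForms F n} (hs : s ∈ T) : s ∉ K := fun hsK =>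
  hT.ne_zero hs ((Submodule.Quotient.mk_eq_zero K).mpr hsK)

theorem dirRep_mem_iff (hT : LinearIndepOn F K.mkQ (T : Set (LinForms F n))) {x : LinForms F n}
    (hx : x ∈ K ⊔ Submodule.span F (T : Set (LinForms F n)) → x ∉ K → dirRep K x ∈ T) :
    dirRep K x ∈ T ↔ x ∈ K ⊔ Submodule.span F (T : Set (LinForms F n)) ∧ x ∉ K := by
  refine ⟨fun h => ⟨?_, ?_⟩, fun h => hx h.1 h.2⟩
  · rw [mem_iff_of_proportionalMod (proportionalMod_mono le_sup_left (proportionalMod_dirRep K x))]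
    exact Submodule.mem_sup_right (Submodule.subset_span h)
  · rw [mem_iff_of_proportionalMod (proportionalMod_dirRep K x)]
    exact notMem_of_linearIndepOn_mkQ hT h

theorem exists_liftLin_innerProd_eq_smul
    (hT : LinearIndepOn F K.mkQ (T : Set (LinForms F n)))
    {Ψ : LinForms F n →ₗ[F] MvPolynomial T (MvPolynomial (Fin n) F)}
    (hΨK : ∀ x ∈ K, Ψ x = C (x : MvPolynomial (Fin n) F)) (hΨT : ∀ s : T, Ψ s = X s)
    (hℓ : ∀ j, ℓ j ∈ K ⊔ Submodule.span F (T : Set (LinForms F n)) → ℓ j ∉ K → dirRep K (ℓ j) ∈ T) :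
    ∃ θ : F, θ ≠ 0 ∧
      liftLin Ψ (innerProd (K ⊔ Submodule.span F (T : Set (LinForms F n))) ℓ) =
        θ • (C (innerProd K ℓ) * ∏ s : T, Polynomial.aeval (X s) (dirPoly K s ℓ)) := by
  classical
  refine ⟨∏ s : T, ∏ j with dirRep K (ℓ j) = s, (dirScale K (ℓ j))⁻¹,
    Finset.prod_ne_zero_iff.mpr fun s _ => Finset.prod_ne_zero_iff.mpr fun j _ =>
      inv_ne_zero (dirScale_ne_zero K _), ?_⟩
  have hinner : ∏ j with ℓ j ∈ K, Ψ (ℓ j) = C (innerProd K ℓ) := by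
    rw [innerProd, formProd, map_prod]
    exact Finset.prod_congr rfl fun j hj => hΨK _ (Finset.mem_filter.mp hj).2
  have hdir (s : T) : ∏ j with dirRep K (ℓ j) = s, Ψ (ℓ j) =
      (∏ j with dirRep K (ℓ j) = s, (dirScale K (ℓ j))⁻¹) •
        Polynomial.aeval (X s) (dirPoly K s ℓ) := by
    rw [dirPoly, map_prod, ← Finset.prod_smul]
    exact Finset.prod_congr rfl fun j hj =>
      apply_eq_smul_aeval_X hΨK hΨT (Finset.mem_filter.mp hj).2
  have houter : ∏ j with dirRep K (ℓ j) ∈ T, Ψ (ℓ j) =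
      ∏ s : T, ∏ j with dirRep K (ℓ j) = s, Ψ (ℓ j) := by
    rw [Finset.prod_coe_sort T fun s => ∏ j with dirRep K (ℓ j) = s, Ψ (ℓ j),
      ← Finset.prod_fiberwise_of_maps_to (g := fun j => dirRep K (ℓ j)) (t := T) (by simp)]
    refine Finset.prod_congr rfl fun s hs => Finset.prod_congr ?_ fun _ _ => rfl
    ext j
    simp only [Finset.mem_filter, Finset.mem_univ, true_and, and_iff_right_iff_imp]
    rintro rfl
    exact hs
  rw [innerProd, liftLin_formProd, ← Finset.prod_filter_mul_prod_filter_not _ (fun j => ℓ j ∈ K),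
    Finset.filter_filter, Finset.filter_filter,
    Finset.filter_congr fun j _ => and_iff_right_of_imp fun h => Submodule.mem_sup_left h,
    Finset.filter_congr fun j _ => (dirRep_mem_iff hT (hℓ j)).symm, hinner, houter]
  simp only [hdir, Finset.prod_smul, mul_smul_comm]

end DirectionPolynomials

section CommonForm

namespace Circuit

variable {F : Type*} [Field F] {n k d : ℕ} {C : Circuit F n k d} {l : Fin k}
  {K : Submodule F (LinForms F n)} {T : Finset (LinForms F n)}

theorem dvd_term_of_smul_eq {i : Fin k} {j : Fin d} {g : LinForms F n} {c : F} (hc : c ≠ 0)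
    (h : c • C.form i j = g) : (g : MvPolynomial (Fin n) F) ∣ C.term i := by
  have hassoc : Associated (C.form i j : MvPolynomial (Fin n) F) g := by
    rw [← h, Submodule.coe_smul, MvPolynomial.smul_eq_C_mul]
    exact associated_unit_mul_right _ _ ((isUnit_iff_ne_zero.mpr hc).map MvPolynomial.C)
  exact hassoc.symm.dvd.trans ((Finset.dvd_prod_of_mem _ (Finset.mem_univ j)).mul_left _)

theorem not_isSimple_of_forall_dirPoly_eq {i : Fin k} {j : Fin d}
    (h : ∀ i', dirPoly K (dirRep K (C.form i j)) (C.form i') =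
      dirPoly K (dirRep K (C.form i j)) (C.form i)) : ¬ C.IsSimple := by
  refine not_not.mpr ⟨dirScale K (C.form i j) • C.form i j,
    smul_ne_zero (dirScale_ne_zero K _) (C.form_ne_zero i j), fun i' => ?_⟩
  have hroot : (dirPoly K (dirRep K (C.form i j)) (C.form i')).IsRoot
      (dirOffset K (C.form i j)).1 := by
    rw [h i', isRoot_dirPoly_iff]
    exact ⟨j, rfl, rfl⟩
  obtain ⟨j', hdir, hoffset⟩ := isRoot_dirPoly_iff.mp hroot
  refine dvd_term_of_smul_eq (j := j') (dirScale_ne_zero K (C.form i' j')) ?_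
  rw [dirScale_smul, dirScale_smul, hdir, Subtype.ext hoffset]

variable [NeZero k]

/-- Enlarging the nucleus by the directions `T` and replacing these by variables turns the relation
between the enlarged nucleus terms into one between the original nucleus terms, with products of
univariate polynomials in separate variables as coefficients. -/
theorem IsNucleus.exists_forall_dirPoly_eq (hK : C.IsNucleus {i | i ≠ l} K) (hzero : C.IsIdentity)
    (hT : LinearIndepOn F K.mkQ (T : Set (LinForms F n))) (hcard : k ≤ T.card + 1)
    (hdir : ∀ i j, C.form i j ∈ K ⊔ Submodule.span F (T : Set (LinForms F n)) → C.form i j ∉ K →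
      dirRep K (C.form i j) ∈ T) :
    ∃ s ∈ T, ∀ i i', dirPoly K s (C.form i) = dirPoly K s (C.form i') := by
  let c : MvPolynomial (Fin n) F →ₐ[F] MvPolynomial T (MvPolynomial (Fin n) F) :=
    IsScalarTower.toAlgHom F _ _
  have hC (a : F) (f : MvPolynomial (Fin n) F) :
      (MvPolynomial.C (a • f) : MvPolynomial T (MvPolynomial (Fin n) F)) = a • MvPolynomial.C f :=
    map_smul c a f
  obtain ⟨Ψ, hΨK, hΨT⟩ := exists_linearMap_of_linearIndependent_mkQ (w := fun s : T => s.1) hT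
    (c.toLinearMap ∘ₗ Submodule.subtype _) X
  choose θ hθ hθΨ using fun i => exists_liftLin_innerProd_eq_smul hT hΨK hΨT (hdir i)
  have hmatched : C.IsMatchedMod (K ⊔ Submodule.span F (T : Set (LinForms F n))) := fun i =>
    (hK.matched i).imp fun _ hπ j => proportionalMod_mono le_sup_left (hπ j)
  obtain ⟨δ, hδ, hsum⟩ := hmatched.exists_sum_smul_nucleusTerm_eq_zero hzero
  have hδθ (i : Fin k) : δ i * θ i ≠ 0 := mul_ne_zero (hδ i) (hθ i)
  have hrel : ∑ i, MvPolynomial.C ((δ i * θ i) • C.nucleusTerm K i) *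
      ∏ s : T, Polynomial.aeval (X s) (dirPoly K s (C.form i)) = 0 := by
    have hΨsum := congrArg (liftLin Ψ) hsum
    simp only [nucleusTerm_eq_innerProd, map_sum, map_smul, hθΨ, map_zero, smul_smul] at hΨsum
    simpa only [hC, smul_mul_assoc, nucleusTerm_eq_innerProd] using hΨsum
  have hmonic (i : Fin k) (s : T) := dirPoly_monic K s.1 (C.form i)
  have hdeg (i : Fin k) (s : T) : (dirPoly K s (C.form i)).natDegree = _ :=
    (hK.matched i).choose_spec.natDegree_dirPoly_eq s.1
  have hmin : NoProperZeroSubsum fun i => (δ i * θ i) • C.nucleusTerm K i :=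
    noProperZeroSubsum_of_linearIndepOn_ne ((linearIndepOn_smul_iff hδθ).mpr hK.indep)
      (sum_eq_zero_of_sum_mul_prod_aeval_X_eq_zero hmonic hdeg hrel)
  have hne : (fun i => (δ i * θ i) • C.nucleusTerm K i) ≠ 0 := fun h0 =>
    smul_ne_zero (hδθ 0) (formProd_ne_zero fun j _ => C.form_ne_zero 0 j) (congrFun h0 0)
  obtain ⟨s, hs⟩ := exists_forall_eq_of_sum_mul_prod_aeval_X_eq_zero hmonic hdeg
    (by simpa using hcard) hne hmin hrel
  exact ⟨s, s.2, hs⟩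

end Circuit

end CommonForm

section SylvesterGallai

variable {F M M' : Type*} [Field F] [AddCommGroup M] [Module F M] [AddCommGroup M'] [Module F M']
  {r m : ℕ} {S : Set M}

theorem IsSGClosed.image (h : IsSGClosed F r S) (e : M ≃ₗ[F] M') : IsSGClosed F r (e '' S) where
  ne_zero := by
    rintro _ ⟨v, hv, rfl⟩
    exact e.map_ne_zero_iff.mpr (h.ne_zero v hv)
  no_multiples := by
    rintro _ ⟨v, hv, rfl⟩ _ ⟨w, hw, rfl⟩ hne c hc
    rw [← map_smul] at hc
    exact h.no_multiples v hv w hw (fun hvw => hne (hvw ▸ rfl)) c (e.injective hc)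
  closed := by
    classical
    intro V' hV' hcard hind
    obtain ⟨V, hVS, rfl⟩ := Finset.subset_set_image_iff.mp hV'
    rw [Finset.card_image_of_injective _ e.injective] at hcard
    rw [Finset.coe_image] at hind ⊢
    have hind' : LinearIndepOn F id (V : Set M) :=
      .of_comp e.toLinearMap ((linearIndepOn_iff_image e.injective.injOn).mpr hind)
    have hspan : (Submodule.span F (e '' (V : Set M)) : Set M') =
        e '' (Submodule.span F (V : Set M) : Set M) := by
      rw [← LinearEquiv.coe_coe, ← Submodule.map_span, Submodule.map_coe]
    rw [hspan, ← Set.image_inter e.injective, e.injective.encard_image]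
    exact h.closed V hVS hcard hind'

theorem IsSGClosed.finrank_le_SG [FiniteDimensional F M] (hr : 1 ≤ r) (h : IsSGClosed F r S)
    (hS : S.encard ≤ m) : Set.finrank F S ≤ SG r F m := by
  let e : M ≃ₗ[F] (Fin (Module.finrank F M) → F) := (Module.finBasis F M).equivFun
  refine (SG_isGreatest hr F m).2 ⟨_, e '' S, ?_, h.image e, ?_⟩
  · rwa [e.injective.encard_image]
  · rw [Set.finrank, Set.finrank, ← LinearEquiv.coe_coe, ← Submodule.map_span]
    exact LinearEquiv.finrank_map_eq e _

variable {K : Submodule F M} {P : Set M}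

theorem rankMod_le_finrank_dirRep [FiniteDimensional F M] (K : Submodule F M) (P : Set M) :
    rankMod K P ≤ Set.finrank F (K.mkQ '' (dirRep K '' P)) := by
  refine Submodule.finrank_mono (Submodule.span_le.mpr ?_)
  rintro _ ⟨x, hx, rfl⟩
  obtain ⟨c, hc, v, hv, hcv⟩ := proportionalMod_dirRep K x
  have hmk : K.mkQ (dirRep K x) = c • K.mkQ x := by
    rw [hcv, map_add, map_smul, K.mkQ_apply v, (Submodule.Quotient.mk_eq_zero K).mpr hv, add_zero]
  rw [SetLike.mem_coe, ← Submodule.smul_mem_iff _ hc, ← hmk]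
  exact Submodule.subset_span ⟨_, ⟨x, hx, rfl⟩, rfl⟩

theorem card_add_one_le_encard_inter_span {V : Finset M} {v : M} (hV : (V : Set M) ⊆ S)
    (hv : v ∈ S) (hvV : v ∉ V) (hspan : v ∈ Submodule.span F (V : Set M)) :
    ((V.card + 1 : ℕ) : ℕ∞) ≤ (S ∩ (Submodule.span F (V : Set M) : Set M)).encard := by
  have hsub := Set.insert_subset (Set.mem_inter hv hspan)
    (Set.subset_inter hV Submodule.subset_span)
  have hle := Set.encard_le_encard hsub
  rwa [Set.encard_insert_of_notMem (by simpa using hvV), Set.encard_coe_eq_coe_finsetCard,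
    ← Nat.cast_add_one] at hle

theorem isSGClosed_mkQ_image_dirRep (hP : ∀ x ∈ P, x ∉ K)
    (h : ∀ T : Finset M, T.card = r → LinearIndepOn F K.mkQ (T : Set M) →
      (T : Set M) ⊆ dirRep K '' P →
      ∃ x ∈ P, x ∈ K ⊔ Submodule.span F (T : Set M) ∧ dirRep K x ∉ T) :
    IsSGClosed F r (K.mkQ '' (dirRep K '' P)) where
  ne_zero := by
    rintro _ ⟨_, ⟨x, hx, rfl⟩, rfl⟩ h0
    exact hP x hx ((mem_iff_of_proportionalMod (proportionalMod_dirRep K x)).mpr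
      ((Submodule.Quotient.mk_eq_zero K).mp h0))
  no_multiples := by
    rintro _ ⟨_, ⟨x, -, rfl⟩, rfl⟩ _ ⟨_, ⟨y, hy, rfl⟩, rfl⟩ hne c hc
    have hc0 : c ≠ 0 := by
      rintro rfl
      rw [zero_smul] at hc
      exact hP y hy ((mem_iff_of_proportionalMod (proportionalMod_dirRep K y)).mpr
        ((Submodule.Quotient.mk_eq_zero K).mp hc))
    exact hne (congrArg K.mkQ (dirRep_eq_of_mkQ_dirRep_eq_smul hc0 hc)).symm
  closed := by
    classical
    intro V hV hcard hind
    obtain ⟨T, hT, rfl⟩ := Finset.subset_set_image_iff.mp hV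
    have hinj := injOn_mkQ_range_dirRep K
    have hTinj : Set.InjOn K.mkQ (T : Set M) := hinj.mono (hT.trans (Set.image_subset_range _ _))
    have hTcard : T.card = r := by rw [← hcard, Finset.card_image_of_injOn hTinj]
    have hTind : LinearIndepOn F K.mkQ (T : Set M) :=
      (linearIndepOn_iff_image hTinj).mpr (by rwa [Finset.coe_image] at hind)
    obtain ⟨x, hxP, hxT, hx⟩ := h T hTcard hTind hT
    have hnotMem : K.mkQ (dirRep K x) ∉ T.image K.mkQ := by
      rwa [← Finset.mem_coe, Finset.coe_image,
        hinj.mem_image_iff (hT.trans (Set.image_subset_range _ _)) (Set.mem_range_self x)]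
    have hspan : K.mkQ (dirRep K x) ∈ Submodule.span F (T.image K.mkQ : Set (M ⧸ K)) := by
      rw [mem_iff_of_proportionalMod (proportionalMod_mono le_sup_left
        (proportionalMod_dirRep K x)), ← Submodule.comap_map_mkQ, Submodule.map_span] at hxT
      rwa [Finset.coe_image]
    rw [← hcard]
    exact card_add_one_le_encard_inter_span hV
      (Set.mem_image_of_mem _ (Set.mem_image_of_mem _ hxP)) hnotMem hspan

end SylvesterGallai

section NonNucleusRank

namespace Circuit

variable {F : Type*} [Field F] {n k d : ℕ} {C : Circuit F n k d} {l : Fin k}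
  {K : Submodule F (LinForms F n)}

theorem term_ne_zero (C : Circuit F n k d) (i : Fin k) : C.term i ≠ 0 := by
  rw [term_eq_smul]
  exact smul_ne_zero (C.coeff_ne_zero i) (formProd_ne_zero fun j _ => C.form_ne_zero i j)

variable [NeZero k]

theorem IsIdentity.two_le (hzero : C.IsIdentity) : 2 ≤ k := by
  by_contra! hlt
  obtain rfl : k = 1 := by
    have := NeZero.pos k
    omega
  exact C.term_ne_zero 0 (by simpa [IsIdentity] using hzero)

theorem IsMatchedMod.dirRep_image_nonNucleusPart_subset (h : C.IsMatchedMod K) :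
    dirRep K '' C.nonNucleusPart K ⊆ Set.range fun j => dirRep K (C.form 0 j) := by
  rintro _ ⟨_, ⟨⟨i, j, rfl⟩, -⟩, rfl⟩
  obtain ⟨π, hπ⟩ := h i
  refine ⟨π.symm j, dirRep_eq_dirRep_iff.mpr ?_⟩
  rw [← π.apply_symm_apply j, Equiv.symm_apply_apply]
  exact hπ (π.symm j)

theorem IsNucleus.isSGClosed (hK : C.IsNucleus {i | i ≠ l} K) (hzero : C.IsIdentity)
    (hsimple : C.IsSimple) :
    IsSGClosed F (k - 1) (K.mkQ '' (dirRep K '' C.nonNucleusPart K)) := by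
  refine isSGClosed_mkQ_image_dirRep (fun x hx => hx.2) fun T hcard hT hTP => ?_
  by_contra! hdir
  obtain ⟨s, hs, heq⟩ := hK.exists_forall_dirPoly_eq hzero hT (by omega)
    fun i j hspan hj => hdir _ ⟨⟨i, j, rfl⟩, hj⟩ hspan
  obtain ⟨_, ⟨⟨i, j, rfl⟩, -⟩, rfl⟩ := hTP hs
  exact not_isSimple_of_forall_dirPoly_eq (fun i' => heq i' i) hsimple

theorem IsNucleus.nonNucleusRank_le_SG (hK : C.IsNucleus {i | i ≠ l} K) (hzero : C.IsIdentity)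
    (hsimple : C.IsSimple) : C.nonNucleusRank K ≤ SG (k - 1) F d := by
  have hk := hzero.two_le
  have hcard : (K.mkQ '' (dirRep K '' C.nonNucleusPart K)).encard ≤ d :=
    calc _ ≤ (dirRep K '' C.nonNucleusPart K).encard := Set.encard_image_le _ _
      _ ≤ (Set.range fun j => dirRep K (C.form 0 j)).encard :=
        Set.encard_le_encard (IsMatchedMod.dirRep_image_nonNucleusPart_subset hK.matched)
      _ ≤ d := by
        rw [← Set.image_univ]
        simpa using Set.encard_image_le (fun j => dirRep K (C.form 0 j)) Set.univ
  exact (rankMod_le_finrank_dirRep K _).trans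
    ((hK.isSGClosed hzero hsimple).finrank_le_SG (by omega) hcard)

end Circuit

end NonNucleusRank

end DepthThree

end

theorem mainTheorem7_general {F : Type*} [Field F] {n k d : ℕ} [NeZero k]
    (C : DepthThree.Circuit F n k d) (hzero : C.IsIdentity) (hsimple : C.IsSimple)
    (hmin : C.IsStronglyMinimal)
    (I : Set (Fin k)) (hI : Maximal (fun J : Set (Fin k) => LinearIndepOn F C.term J) I) :
    (∃ K : Submodule F (DepthThree.LinForms F n), C.IsNucleus I K) ∧
      ∀ K : Submodule F (DepthThree.LinForms F n), C.IsNucleus I K →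
        C.nonNucleusRank K ≤ DepthThree.SG (k - 1) F d := by
  refine ⟨DepthThree.Circuit.exists_isNucleus hzero hmin hI.1, fun K hK => ?_⟩
  obtain ⟨l, rfl⟩ := DepthThree.Circuit.exists_eq_ne_of_maximal hzero hmin hI
  exact hK.nonNucleusRank_le_SG hzero hsimple

theorem mainTheorem7 {F : Type*} [Field F] {n k d : ℕ} [NeZero k]
    (hF : (d : ℕ∞) < ENat.card F)
    (C : DepthThree.Circuit F n k d) (hzero : C.IsIdentity) (hsimple : C.IsSimple)
    (hmin : C.IsStronglyMinimal)
    (I : Set (Fin k)) (hI : Maximal (fun J : Set (Fin k) => LinearIndepOn F C.term J) I) :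
    (∃ K : Submodule F (DepthThree.LinForms F n), C.IsNucleus I K) ∧
      ∀ K : Submodule F (DepthThree.LinForms F n), C.IsNucleus I K →
        C.nonNucleusRank K ≤ DepthThree.SG (k - 1) F d :=
  mainTheorem7_general C hzero hsimple hmin I hI
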